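/- Notation. Let $q\in\mathbb C$, $0<|q|<1$, $(a)_n=\prod_{j=0}^{n-1}(1-aq^j)$, $(a)_\infty=\prod_{j\ge 0}(1-aq^j)$, $(a_1,\dots,a_m)_\infty=\prod_i (a_i)_\infty$, and $${}_3\phi_2\left({a,b,c\atop d,e};t\right)=\sum_{k\ge 0}\frac{(a)_k(b)_k(c)_k}{(d)_k(e)_k(q)_k}t^k\qquad(|t|<1).$$ When $t=de/(abc)$ and $|t|\ge 1$, the symbol denotes the analytic continuation, given for $|a|<1$ by $${}_3\phi_2\left({a,b,c\atop d,e};\tfrac{de}{abc}\right)=\frac{(a,\frac{de}{ab},\frac{de}{ac})_\infty}{(d,e,\frac{de}{abc})_\infty}\;{}_3\phi_2\left({\frac da,\frac ea,\frac{de}{abc}\atop \frac{de}{ab},\frac{de}{ac}};a\right),$$ where removable singularities are removed, i.e. $(u,v)_\infty\,{}_3\phi_2\left({\cdot,\cdot,\cdot\atop u,v};a\right)$ is read termwise with $(u)_\infty/(u)_k=(uq^k)_\infty$. (Below $\frac{de}{abc}=AD\lambda_-$ and $a=BC\lambda_-$ always, and $|AD\lambda_-\cdot BC\lambda_-|=|q\lambda_-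 /\lambda_+|<1$, so this covers every case.) Let $A,B,C,D\in\mathbb C\setminus\{0\}$ and $$a_n=\Big(\tfrac1A+\tfrac1B+\tfrac1C+\tfrac1D\Big)q^n-(1+q)q^{2n-1},$$ $$b_n^2=\tfrac{q}{ABCD}(1-Aq^{n-1})(1-Bq^{n-1})(1-Cq^{n-1})(1-Dq^{n-1}),$$ and assume $b_n^2\neq 0$ for all $n>0$. Consider the infinite J-fraction $$CF(z)=z-a_0-\cfrac{b_1^2}{z-a_1-\cfrac{b_2^2}{z-a_2-\cdots}}$$ attached to the recurrence $X_{n+1}-(z-a_n)X_n+b_n^2X_{n-1}=0$. Let $\alpha=\frac12\sqrt{ABCD/q}$ (either root), $x=\alpha z$, and let $\Omega$ be the set of all $z$ with $x\in\mathbb C\setminus[-1,1]$. For $z\in\Omega$ put $\lambda_\pm=\frac1{2\alpha}\big(x\pm\sqrt{x^2-1}\big)$ with the branch of the root, namely $\sqrt{x^2-1}=x(1-x^{-2})^{1/2}$ with the principal power, for which $|\lambda_- /\lambda_+|<1$. Theorem. For every $z\in\Omega$ the reciprocals of the convergents of $CF(z)$ converge on the Riemann sphere $\mathbb C\cup\{\infty\}$;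 the limit $1/CF(z)$ is a continuous function from $\Omega$ to the sphere, and the following hold for all $z\in\Omega$. In (1)–(3), equality with a quotient is equality on the sphere (numerator over denominator, everything cleared), and numerator and denominator do not both vanish. (1) If none of $BCD\lambda_- /q,\ ABC\lambda_- /q,\ AD\lambda_-$ is of the form $q^{-k}$, $k=0,1,2,\dots$ (that is, if the functions below are defined), then $$\frac1{CF(z)}=\frac{ABCD\lambda_-}{q\big(1-\frac{BCD\lambda_-}q\big)\big(1-\frac{ABC\lambda_-}q\big)}\;\frac{{}_3\phi_2\left({BC\lambda_-,\,B,\,C\atop BCD\lambda_-,\,ABC\lambda_-};AD\lambda_-\right)}{{}_3\phi_2\left({BC\lambda_-,\,B/q,\,C/q\atop BCD\lambda_- /q,\,ABC\lambda_- /q};AD\lambda_-\right)}$$ and also $$\frac1{CF(z)}=\frac{1}{\lambda_+\big(1-\frac1{A\lambda_+}\big)\big(1-\frac1{D\lambda_+}\big)}\;\frac{{}_3\phi_2\left({BC\lambda_-,\,B,\,C\atop q/(A\lambda_+),\,q/(D\lambda_+)};AD\lambda_-\right)}{{}_3\phi_2\left({BC\lambda_-,\,B/q,\,C/q\atop 1/(A\lambda_+),\,1/(D\lambda_+)};AD\lambda_-\right)}.$$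 (2) If $C=q$ and none of $BDq\lambda_-,\ ABq\lambda_-,\ AD\lambda_-$ is of the form $q^{-k}$, $k\ge0$, then $$\frac1{CF(z)}=\frac{ABD\lambda_-}{(1-BD\lambda_-)(1-AB\lambda_-)}\;{}_3\phi_2\left({Bq\lambda_-,\,B,\,q\atop DBq\lambda_-,\,ABq\lambda_-};AD\lambda_-\right).$$ (3) If $C=q$ and $ABD\lambda_-$ is not of the form $q^{-k}$, $k\ge0$, then $$\frac1{CF(z)}=\frac{ABD\lambda_-\,(q,\,ABD\lambda_-,\,ABDq\lambda_-^2)_\infty}{(BD\lambda_-,\,AB\lambda_-,\,AD\lambda_-)_\infty}\;{}_3\phi_2\left({BD\lambda_-,\,AB\lambda_-,\,AD\lambda_-\atop ABD\lambda_-,\,ABDq\lambda_-^2};q\right).$$ (4) If $C=q$, then $1/CF(z)=\infty$ (a pole) if and only if $(BD\lambda_-,AB\lambda_-,AD\lambda_-)_\infty=0$. -/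

import Mathlib

open Filter Topology

noncomputable section

namespace DualQHahn

/-- The finite shifted factorial `(a; q)_n = ∏_{j < n} (1 - a q^j)`. -/
def qPoch (q a : ℂ) (n : ℕ) : ℂ := ∏ j ∈ Finset.range n, (1 - a * q ^ j)

/-- The infinite shifted factorial `(a; q)_∞ = ∏_{j ≥ 0} (1 - a q^j)` (for `|q| < 1`). -/
def qPochInf (q a : ℂ) : ℂ := ∏' j : ℕ, (1 - a * q ^ j)

/-- The basic hypergeometric series `₃φ₂(a, b, c; d, e; q, z)` (for `|q| < 1`, `|z| < 1`, and
`d, e` not of the form `q^{-k}`, `k ≥ 0`). -/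
def phiSeries (q a b c d e z : ℂ) : ℂ :=
  ∑' k : ℕ, qPoch q a k * qPoch q b k * qPoch q c k /
    (qPoch q d k * qPoch q e k * qPoch q q k) * z ^ k

/-- The series `(d, e; q)_∞ ₃φ₂(a, b, c; d, e; q, z)`, written with `(d; q)_∞ / (d; q)_k =
(d q^k; q)_∞`, so that it also makes sense when `d` or `e` is of the form `q^{-k}`. -/
def phiSeriesReg (q a b c d e z : ℂ) : ℂ :=
  ∑' k : ℕ, qPoch q a k * qPoch q b k * qPoch q c k / qPoch q q k *
    (qPochInf q (d * q ^ k) * qPochInf q (e * q ^ k)) * z ^ k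

open Classical in
/-- The function `φ(a, b, c, d, e)`: the series `₃φ₂(a, b, c; d, e; q, de/(abc))` when
`|de/(abc)| < 1`, and otherwise its analytic continuation, given (for `|a| < 1`) by the transformation
`φ(a,b,c,d,e) = (a, de/(ab), de/(ac))_∞ / (d, e, de/(abc))_∞ *
  ₃φ₂(de/(abc), d/a, e/a; de/(ab), de/(ac); q, a)`.
The poles are at `d`, `e` or `de/(abc)` of the form `q^{-k}`, `k ≥ 0`. -/
def phi (q a b c d e : ℂ) : ℂ :=
  if ‖d * e / (a * b * c)‖ < 1 then
    phiSeries q a b c d e (d * e / (a * b * c))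
  else
    qPochInf q a / (qPochInf q d * qPochInf q e * qPochInf q (d * e / (a * b * c))) *
      phiSeriesReg q (d * e / (a * b * c)) (d / a) (e / a) (d * e / (a * b)) (d * e / (a * c)) a

/-- The coefficient `a_n` of the recurrence `X_{n+1} - (z - a_n) X_n + b_n² X_{n-1} = 0`. -/
def coeffA (q A B C D : ℂ) (n : ℤ) : ℂ :=
  (1 / A + 1 / B + 1 / C + 1 / D) * q ^ n - (1 + q) * q ^ (2 * n - 1)

/-- The coefficient `b_n²` of the recurrence `X_{n+1} - (z - a_n) X_n + b_n² X_{n-1} = 0`. -/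
def coeffBsq (q A B C D : ℂ) (n : ℤ) : ℂ :=
  q / (A * B * C * D) * (1 - A * q ^ (n - 1)) * (1 - B * q ^ (n - 1)) *
    (1 - C * q ^ (n - 1)) * (1 - D * q ^ (n - 1))

/-- The infinite J-fraction `CF(z) = z - a_0 - b_1²/(z - a_1 - b_2²/(z - a_2 - ⋯))`, as a formal
continued fraction. -/
def jFraction (q A B C D z : ℂ) : GenContFract ℂ where
  h := z - coeffA q A B C D 0
  s := Stream'.Seq.ofStream fun n : ℕ =>
    { a := -coeffBsq q A B C D ((n : ℤ) + 1), b := z - coeffA q A B C D ((n : ℤ) + 1) }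

/-- The point `u / v` of the Riemann sphere `ℂ ∪ {∞}`, with `u / 0 = ∞`
(meaningful when `u` and `v` are not both zero). -/
def sphereQuot (u v : ℂ) : OnePoint ℂ :=
  if v = 0 then OnePoint.infty else ((u / v : ℂ) : OnePoint ℂ)

/-- `w = u / v` on the Riemann sphere, where `u` and `v` are not both zero. -/
def EqQuot (w : OnePoint ℂ) (u v : ℂ) : Prop :=
  (u ≠ 0 ∨ v ≠ 0) ∧ w = sphereQuot u v

/-- The reciprocal of the `n`-th convergent `A_n / B_n` of `CF(z)`, a point of the Riemann sphere. -/
def recipConvergent (q A B C D z : ℂ) (n : ℕ) : OnePoint ℂ :=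
  sphereQuot ((jFraction q A B C D z).dens n) ((jFraction q A B C D z).nums n)

/-- The branch of `√(x² - 1)` on `ℂ \ [-1, 1]` that behaves like `x` at infinity. -/
def sqrtBranch (x : ℂ) : ℂ := x * (1 - 1 / x ^ 2) ^ (1 / 2 : ℂ)

/-- `λ₊ = (x + √(x² - 1)) / (2α)` with `x = α z`. -/
def lamPlus (α z : ℂ) : ℂ := (α * z + sqrtBranch (α * z)) / (2 * α)

/-- `λ₋ = (x - √(x² - 1)) / (2α)` with `x = α z`. -/
def lamMinus (α z : ℂ) : ℂ := (α * z - sqrtBranch (α * z)) / (2 * α)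

/-- The set of all `z` with `x = α z ∈ ℂ \ [-1, 1]`. -/
def offCut (α : ℂ) : Set ℂ := {z | α * z ∉ Complex.ofReal '' Set.Icc (-1 : ℝ) 1}

/-- `t` is not one of the zeros `q^{-k}`, `k ≥ 0`, of `(t; q)_∞`. -/
def NotQPole (q t : ℂ) : Prop := ∀ k : ℕ, t * q ^ k ≠ 1

end DualQHahn

end

/-! The proof is Pincherle's theorem with an explicit minimal solution. Write `l = λ₋`, `lp = λ₊ =
q/(ABCDl)` and let F(x) = (BCDlx, ABClx)_∞ ₃φ₂(BCl, Bx, Cx; BCDlx, ABClx; ADl), with the lower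
parameters cleared. F satisfies a second-order q-difference equation in x (`solSeries_contiguous`),
proved by telescoping with a rational certificate. At x = q^n it says that X_n = l^n (A,B,C,D)_n
F(q^n) solves the recurrence of the J-fraction, and at x = 1 that lp F(1/q) plays the role of b_0²
X_{-1}.

As n → ∞, X_n / l^n tends to (A,B,C,D)_∞ times a q-binomial series. Both are nonzero, so X is
minimal because |l| < |lp|. The Casoratian of X with any other solution is explicit; dividing it out
leaves a first-order recurrence whose solution, scaled by lp^n, converges to a constant times the
initial Casoratian (`tendsto_div_pow_of_recurrence`). For the denominators and numerators of the
convergents these initial values are F(1) and lp F(1/q), so 1/CF = F(1) / (lp F(1/q)) on the sphere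
(`tendsto_recipConvergent`).

This needs |ADl| < 1. Since |ADl · BCl| = |q l/lp| < 1, otherwise |BCl| < 1, and the coefficients
are symmetric in A, B, C, D, so the argument applies to (B, D, A, C). The resulting series is the
one that defines the continuation of φ.

If C = q, then F(1/q) is a product, because its series stops at once or is summed by q-Gauss. F(1)
becomes a series of argument q by the identity theorem (`qSeries_eq_phiSeriesReg`). For the permuted
solution the same evaluation follows by comparing the two expressions for 1/CF at small l and
continuing in l. -/

namespace DualQHahn

variable {q : ℂ}

/-! ### Shifted factorials -/

@[simp] lemma qPoch_zero (q a : ℂ) : qPoch q a 0 = 1 := by simp [qPoch]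

lemma qPoch_succ (q a : ℂ) (n : ℕ) : qPoch q a (n + 1) = qPoch q a n * (1 - a * q ^ n) :=
  Finset.prod_range_succ _ _

lemma qPoch_succ' (q a : ℂ) (n : ℕ) : qPoch q a (n + 1) = (1 - a) * qPoch q (a * q) n := by
  unfold qPoch
  rw [Finset.prod_range_succ', mul_comm]
  simp [pow_succ', mul_assoc]

@[simp] lemma qPoch_zero_left (q : ℂ) (n : ℕ) : qPoch q 0 n = 1 := by simp [qPoch]

lemma qPoch_one_succ (q : ℂ) (n : ℕ) : qPoch q 1 (n + 1) = 0 := by simp [qPoch_succ']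

lemma summable_norm_mul_pow (hq : ‖q‖ < 1) (a : ℂ) : Summable fun j : ℕ => ‖-(a * q ^ j)‖ := by
  simpa [norm_mul, norm_pow] using
    (summable_geometric_of_lt_one (norm_nonneg q) hq).mul_left ‖a‖

lemma multipliable_one_sub_mul_pow (hq : ‖q‖ < 1) (a : ℂ) :
    Multipliable fun j : ℕ => 1 - a * q ^ j := by
  simpa [sub_eq_add_neg] using multipliable_one_add_of_summable (summable_norm_mul_pow hq a)

lemma tendsto_qPoch (hq : ‖q‖ < 1) (a : ℂ) :
    Tendsto (qPoch q a) atTop (𝓝 (qPochInf q a)) :=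
  (multipliable_one_sub_mul_pow hq a).hasProd.tendsto_prod_nat

lemma qPochInf_eq_mul (hq : ‖q‖ < 1) (a : ℂ) :
    qPochInf q a = (1 - a) * qPochInf q (a * q) := by
  have h := (tendsto_qPoch hq a).comp (tendsto_add_atTop_nat 1)
  refine tendsto_nhds_unique h ?_
  have : qPoch q a ∘ (fun n => n + 1) = fun n => (1 - a) * qPoch q (a * q) n := by
    funext n
    exact qPoch_succ' q a n
  rw [this]
  exact (tendsto_qPoch hq _).const_mul _

lemma qPochInf_mul_pow_eq (hq : ‖q‖ < 1) (a : ℂ) (n : ℕ) :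
    qPochInf q (a * q ^ n) = (1 - a * q ^ n) * qPochInf q (a * q ^ (n + 1)) := by
  rw [qPochInf_eq_mul hq, pow_succ, mul_assoc]

lemma qPoch_mul_qPochInf (hq : ‖q‖ < 1) (a : ℂ) (n : ℕ) :
    qPoch q a n * qPochInf q (a * q ^ n) = qPochInf q a := by
  induction n with
  | zero => simp
  | succ n ih => rw [qPoch_succ, mul_assoc, ← qPochInf_mul_pow_eq hq, ih]

@[simp] lemma qPochInf_zero (q : ℂ) : qPochInf q 0 = 1 := by simp [qPochInf]

lemma qPochInf_ne_zero (hq : ‖q‖ < 1) {a : ℂ} (ha : NotQPole q a) : qPochInf q a ≠ 0 := by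
  have := tprod_one_add_ne_zero_of_summable (f := fun j : ℕ => -(a * q ^ j))
    (fun j h => ha j (by linear_combination -h)) (summable_norm_mul_pow hq a)
  simpa [qPochInf, sub_eq_add_neg] using this

lemma notQPole_of_norm_lt_one (hq : ‖q‖ < 1) {a : ℂ} (ha : ‖a‖ < 1) : NotQPole q a := by
  intro k h
  have : ‖a * q ^ k‖ < 1 := by
    rw [norm_mul, norm_pow]
    exact mul_lt_one_of_nonneg_of_lt_one_left (norm_nonneg _) ha
      (pow_le_one₀ (norm_nonneg _) hq.le)
  rw [h, norm_one] at this
  exact lt_irrefl _ this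

lemma qPochInf_ne_zero_of_norm_lt_one (hq : ‖q‖ < 1) {a : ℂ} (ha : ‖a‖ < 1) :
    qPochInf q a ≠ 0 :=
  qPochInf_ne_zero hq (notQPole_of_norm_lt_one hq ha)

lemma NotQPole.mul_self {a : ℂ} (ha : NotQPole q a) : NotQPole q (a * q) := fun k h =>
  ha (k + 1) (by rw [← h]; ring)

lemma NotQPole.qPoch_ne_zero {a : ℂ} (ha : NotQPole q a) (n : ℕ) : qPoch q a n ≠ 0 :=
  Finset.prod_ne_zero_iff.mpr fun j _ h => ha j (by linear_combination -h)

lemma qPoch_self_ne_zero (hq : ‖q‖ < 1) (n : ℕ) : qPoch q q n ≠ 0 :=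
  (notQPole_of_norm_lt_one hq hq).qPoch_ne_zero n

lemma inv_qPoch_self (hq : ‖q‖ < 1) (m : ℕ) :
    (qPoch q q m)⁻¹ = (1 - q * q ^ m) * (qPoch q q (m + 1))⁻¹ := by
  have h2 := qPoch_self_ne_zero hq (m + 1)
  rw [qPoch_succ] at h2 ⊢
  field_simp [right_ne_zero_of_mul h2, left_ne_zero_of_mul h2]

lemma qPochInf_mul_pow_succ_eq (hq : ‖q‖ < 1) (d : ℂ) (m : ℕ) :
    qPochInf q (d * q ^ (m + 1)) = (1 - d * (q * q ^ m)) * qPochInf q (d * q ^ (m + 2)) := by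
  rw [qPochInf_mul_pow_eq hq, pow_succ' q m]

/-! ### Uniform bounds and analyticity of the shifted factorials -/

lemma sum_norm_pow_le (hq : ‖q‖ < 1) (n : ℕ) :
    ∑ j ∈ Finset.range n, ‖q‖ ^ j ≤ (1 - ‖q‖)⁻¹ := by
  rw [← tsum_geometric_of_lt_one (norm_nonneg q) hq]
  exact (summable_geometric_of_lt_one (norm_nonneg q) hq).sum_le_tsum _
    fun j _ => by positivity

/-- Pull ρ out of each factor and use 1 + t ≤ exp t; the exponents form a convergent geometric
series, so the growth is exactly of order ρ^n. -/
lemma prod_add_mul_pow_le (hq : ‖q‖ < 1) {ρ M : ℝ} (hρ : 0 < ρ) (hM : 0 ≤ M) (n : ℕ) :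
    ∏ j ∈ Finset.range n, (ρ + M * ‖q‖ ^ j) ≤ ρ ^ n * Real.exp (M / ρ * (1 - ‖q‖)⁻¹) := by
  calc ∏ j ∈ Finset.range n, (ρ + M * ‖q‖ ^ j)
      ≤ ∏ j ∈ Finset.range n, (ρ * Real.exp (M / ρ * ‖q‖ ^ j)) := by
        refine Finset.prod_le_prod (fun j _ => by positivity) fun j _ => ?_
        have := Real.add_one_le_exp (M / ρ * ‖q‖ ^ j)
        calc ρ + M * ‖q‖ ^ j = ρ * (M / ρ * ‖q‖ ^ j + 1) := by field_simp; ring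
          _ ≤ _ := by gcongr
    _ = ρ ^ n * Real.exp (M / ρ * ∑ j ∈ Finset.range n, ‖q‖ ^ j) := by
        rw [Finset.prod_mul_distrib, Finset.prod_const, Finset.card_range, ← Real.exp_sum,
          Finset.mul_sum]
    _ ≤ _ := by
        gcongr
        exact sum_norm_pow_le hq n

lemma norm_prod_sub_mul_pow_le (hq : ‖q‖ < 1) {ρ M : ℝ} (hρ : 0 < ρ) {w s : ℂ}
    (hw : ‖w‖ ≤ ρ) (hs : ‖s‖ ≤ M) (n : ℕ) :
    ‖∏ j ∈ Finset.range n, (w - s * q ^ j)‖ ≤ ρ ^ n * Real.exp (M / ρ * (1 - ‖q‖)⁻¹) := by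
  refine le_trans ?_ (prod_add_mul_pow_le hq hρ ((norm_nonneg s).trans hs) n)
  rw [norm_prod]
  refine Finset.prod_le_prod (fun j _ => norm_nonneg _) fun j _ => ?_
  refine (norm_sub_le _ _).trans ?_
  rw [norm_mul, norm_pow]
  gcongr

lemma norm_qPoch_le (hq : ‖q‖ < 1) {M : ℝ} {a : ℂ} (ha : ‖a‖ ≤ M) (n : ℕ) :
    ‖qPoch q a n‖ ≤ Real.exp (M * (1 - ‖q‖)⁻¹) := by
  simpa [qPoch] using norm_prod_sub_mul_pow_le hq one_pos (w := 1) (by simp) ha n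

lemma norm_qPochInf_le (hq : ‖q‖ < 1) {M : ℝ} {a : ℂ} (ha : ‖a‖ ≤ M) :
    ‖qPochInf q a‖ ≤ Real.exp (M * (1 - ‖q‖)⁻¹) :=
  le_of_tendsto (tendsto_qPoch hq a).norm (Eventually.of_forall fun n => norm_qPoch_le hq ha n)

lemma exists_norm_inv_qPoch_self_le (hq : ‖q‖ < 1) :
    ∃ K : ℝ, 0 ≤ K ∧ ∀ n, ‖(qPoch q q n)⁻¹‖ ≤ K := by
  have h := (tendsto_qPoch hq q).inv₀ (qPochInf_ne_zero_of_norm_lt_one hq hq)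
  obtain ⟨K, hK⟩ := (Metric.isBounded_range_of_tendsto _ h).exists_norm_le
  exact ⟨K, (norm_nonneg _).trans (hK _ ⟨0, rfl⟩), fun n => hK _ ⟨n, rfl⟩⟩

lemma norm_mul_pow_le (hq : ‖q‖ < 1) {M : ℝ} {a : ℂ} (ha : ‖a‖ ≤ M) (k : ℕ) :
    ‖a * q ^ k‖ ≤ M := by
  rw [norm_mul, norm_pow]
  exact (mul_le_of_le_one_right (norm_nonneg _) (pow_le_one₀ (norm_nonneg _) hq.le)).trans ha

lemma differentiable_qPoch (q : ℂ) (n : ℕ) : Differentiable ℂ fun a => qPoch q a n := by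
  unfold qPoch
  fun_prop

lemma differentiable_qPochInf (hq : ‖q‖ < 1) : Differentiable ℂ (qPochInf q) := by
  intro a
  have hU : IsOpen (Metric.ball (0 : ℂ) (‖a‖ + 1)) := Metric.isOpen_ball
  have h := Summable.hasProdLocallyUniformlyOn_nat_one_add (f := fun (j : ℕ) (a : ℂ) => -(a * q ^ j)) hU
    ((summable_geometric_of_lt_one (norm_nonneg q) hq).mul_left (‖a‖ + 1))
    (Eventually.of_forall fun n x hx => by
      rw [norm_neg, norm_mul, norm_pow]
      have : ‖x‖ < ‖a‖ + 1 := by simpa using hx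
      gcongr) (fun n => by fun_prop)
  have h2 : DifferentiableOn ℂ (fun x => ∏' j : ℕ, (1 + -(x * q ^ j)))
      (Metric.ball (0 : ℂ) (‖a‖ + 1)) := by
    refine TendstoLocallyUniformlyOn.differentiableOn h
      (Eventually.of_forall fun s => ?_) hU
    exact DifferentiableOn.fun_finsetProd fun i _ => by fun_prop
  have h3 := h2.differentiableAt (x := a) (hU.mem_nhds (by simp))
  have h4 : qPochInf q = fun x => ∏' j : ℕ, (1 + -(x * q ^ j)) := by
    funext x
    simp [qPochInf, sub_eq_add_neg]
  rwa [h4]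

lemma tendsto_pow_zero (hq : ‖q‖ < 1) : Tendsto (fun n : ℕ => q ^ n) atTop (𝓝 0) :=
  tendsto_pow_atTop_nhds_zero_of_norm_lt_one hq

lemma tendsto_qPochInf_mul_pow (hq : ‖q‖ < 1) (a : ℂ) :
    Tendsto (fun n : ℕ => qPochInf q (a * q ^ n)) atTop (𝓝 1) := by
  have h1 : Tendsto (fun n : ℕ => a * q ^ n) atTop (𝓝 0) := by
    simpa using (tendsto_pow_zero hq).const_mul a
  have := ((differentiable_qPochInf hq).continuous.tendsto 0).comp h1
  rwa [qPochInf_zero] at this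

/-! ### The regularised series with a homogeneous numerator factor -/

/-- The `k`-th term of `qSeries`. -/
noncomputable def qTerm (q s w a b d e : ℂ) (k : ℕ) : ℂ :=
  (∏ j ∈ Finset.range k, (w - s * q ^ j)) * (qPoch q a k * qPoch q b k) * (qPoch q q k)⁻¹ *
    (qPochInf q (d * q ^ k) * qPochInf q (e * q ^ k))

/-- The series `phiSeriesReg q c a b d e w` with `s = c w`, where `c = s / w` may be infinite. -/
noncomputable def qSeries (q s w a b d e : ℂ) : ℂ := ∑' k : ℕ, qTerm q s w a b d e k

lemma prod_sub_mul_mul_pow (q c w : ℂ) (k : ℕ) :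
    ∏ j ∈ Finset.range k, (w - w * c * q ^ j) = qPoch q c k * w ^ k := by
  have : w ^ k = ∏ _j ∈ Finset.range k, w := by simp
  rw [qPoch, this, ← Finset.prod_mul_distrib]
  exact Finset.prod_congr rfl fun j _ => by ring

/-- With the powers of the argument absorbed into the factors w - s q^j, every term is analytic in
all parameters separately. In particular w may vary with s fixed, which the transformation to
argument q needs. -/
lemma phiSeriesReg_eq_qSeries (q a b c d e z : ℂ) :
    phiSeriesReg q a b c d e z = qSeries q (z * a) z b c d e := by
  unfold phiSeriesReg qSeries qTerm
  refine tsum_congr fun k => ?_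
  rw [prod_sub_mul_mul_pow]
  ring

/-- A geometric majorant that is uniform on bounded sets of parameters with |w| ≤ ρ. It gives
summability when ρ < 1, and analyticity through the Weierstrass M-test. -/
lemma norm_qTerm_le (hq : ‖q‖ < 1) {ρ M K : ℝ} (hρ : 0 < ρ)
    (hK : ∀ n, ‖(qPoch q q n)⁻¹‖ ≤ K) {s w a b d e : ℂ} (hw : ‖w‖ ≤ ρ) (hs : ‖s‖ ≤ M)
    (ha : ‖a‖ ≤ M) (hb : ‖b‖ ≤ M) (hd : ‖d‖ ≤ M) (he : ‖e‖ ≤ M) (k : ℕ) :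
    ‖qTerm q s w a b d e k‖ ≤ Real.exp (M / ρ * (1 - ‖q‖)⁻¹) *
      Real.exp (M * (1 - ‖q‖)⁻¹) ^ 4 * K * ρ ^ k := by
  have h1 := norm_prod_sub_mul_pow_le hq hρ hw hs k
  have h2 := norm_qPoch_le hq ha k
  have h3 := norm_qPoch_le hq hb k
  have h4 := norm_qPochInf_le hq (norm_mul_pow_le hq hd k)
  have h5 := norm_qPochInf_le hq (norm_mul_pow_le hq he k)
  have hK0 : 0 ≤ K := (norm_nonneg _).trans (hK 0)
  calc ‖qTerm q s w a b d e k‖ ≤ (ρ ^ k * Real.exp (M / ρ * (1 - ‖q‖)⁻¹)) *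
        (Real.exp (M * (1 - ‖q‖)⁻¹) * Real.exp (M * (1 - ‖q‖)⁻¹)) * K *
        (Real.exp (M * (1 - ‖q‖)⁻¹) * Real.exp (M * (1 - ‖q‖)⁻¹)) := by
        unfold qTerm
        simp only [norm_mul]
        gcongr
        exact hK k
    _ = _ := by ring

lemma summable_qTerm (hq : ‖q‖ < 1) {w : ℂ} (hw : ‖w‖ < 1) (s a b d e : ℂ) :
    Summable (qTerm q s w a b d e) := by
  obtain ⟨K, _, hK⟩ := exists_norm_inv_qPoch_self_le hq
  obtain ⟨ρ, hρ, hρ1⟩ := exists_between hw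
  have hρ0 : 0 < ρ := (norm_nonneg _).trans_lt hρ
  set M := ‖s‖ + ‖a‖ + ‖b‖ + ‖d‖ + ‖e‖ with hM
  have := norm_nonneg s; have := norm_nonneg a; have := norm_nonneg b
  have := norm_nonneg d; have := norm_nonneg e
  refine Summable.of_norm_bounded ((summable_geometric_of_lt_one hρ0.le hρ1).mul_left _)
    (norm_qTerm_le hq hρ0 hK hρ.le (M := M) ?_ ?_ ?_ ?_ ?_) <;> linarith

lemma differentiable_qTerm (hq : ‖q‖ < 1) (k : ℕ) {U : Set ℂ} {s w a b d e : ℂ → ℂ}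
    (hs : DifferentiableOn ℂ s U) (hw : DifferentiableOn ℂ w U) (ha : DifferentiableOn ℂ a U)
    (hb : DifferentiableOn ℂ b U) (hd : DifferentiableOn ℂ d U) (he : DifferentiableOn ℂ e U) :
    DifferentiableOn ℂ (fun z => qTerm q (s z) (w z) (a z) (b z) (d z) (e z) k) U := by
  unfold qTerm
  have h1 : DifferentiableOn ℂ (fun z => ∏ j ∈ Finset.range k, (w z - s z * q ^ j)) U :=
    DifferentiableOn.fun_finsetProd fun i _ => by fun_prop
  have h2 : DifferentiableOn ℂ (fun z => qPoch q (a z) k) U :=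
    (differentiable_qPoch q k).comp_differentiableOn ha
  have h3 : DifferentiableOn ℂ (fun z => qPoch q (b z) k) U :=
    (differentiable_qPoch q k).comp_differentiableOn hb
  have h4 : DifferentiableOn ℂ (fun z => qPochInf q (d z * q ^ k)) U :=
    (differentiable_qPochInf hq).comp_differentiableOn (hd.mul_const _)
  have h5 : DifferentiableOn ℂ (fun z => qPochInf q (e z * q ^ k)) U :=
    (differentiable_qPochInf hq).comp_differentiableOn (he.mul_const _)
  fun_prop

lemma differentiableOn_qSeries (hq : ‖q‖ < 1) {U : Set ℂ} (hU : IsOpen U)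
    {s w a b d e : ℂ → ℂ} (hw1 : ∀ z ∈ U, ‖w z‖ < 1)
    (hs : DifferentiableOn ℂ s U) (hw : DifferentiableOn ℂ w U) (ha : DifferentiableOn ℂ a U)
    (hb : DifferentiableOn ℂ b U) (hd : DifferentiableOn ℂ d U) (he : DifferentiableOn ℂ e U) :
    DifferentiableOn ℂ (fun z => qSeries q (s z) (w z) (a z) (b z) (d z) (e z)) U := by
  intro z₀ hz₀
  obtain ⟨K, _, hK⟩ := exists_norm_inv_qPoch_self_le hq
  obtain ⟨ρ, hρ, hρ1⟩ := exists_between (hw1 z₀ hz₀)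
  have hρ0 : 0 < ρ := (norm_nonneg _).trans_lt hρ
  set M := ‖s z₀‖ + ‖a z₀‖ + ‖b z₀‖ + ‖d z₀‖ + ‖e z₀‖ + 1 with hM
  have n1 := norm_nonneg (s z₀)
  have n2 := norm_nonneg (a z₀)
  have n3 := norm_nonneg (b z₀)
  have n4 := norm_nonneg (d z₀)
  have n5 := norm_nonneg (e z₀)
  have key : ∀ {f : ℂ → ℂ} {r : ℝ}, DifferentiableOn ℂ f U → ‖f z₀‖ < r →
      ∀ᶠ z in 𝓝 z₀, ‖f z‖ ≤ r := fun {f r} hf hr =>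
    ((hf.continuousOn.continuousAt (hU.mem_nhds hz₀)).norm.eventually_lt_const hr).mono
      fun z hz => hz.le
  have hev : ∀ᶠ z in 𝓝 z₀, z ∈ U ∧ ‖w z‖ ≤ ρ ∧ ‖s z‖ ≤ M ∧ ‖a z‖ ≤ M ∧ ‖b z‖ ≤ M ∧
      ‖d z‖ ≤ M ∧ ‖e z‖ ≤ M := by
    filter_upwards [hU.mem_nhds hz₀, key hw hρ, key hs (r := M) (by linarith),
      key ha (r := M) (by linarith), key hb (r := M) (by linarith),
      key hd (r := M) (by linarith), key he (r := M) (by linarith)] with z h1 h2 h3 h4 h5 h6 h7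
    exact ⟨h1, h2, h3, h4, h5, h6, h7⟩
  obtain ⟨V, hV, hVo, hzV⟩ := eventually_nhds_iff.mp hev
  have hVU : V ⊆ U := fun z hz => (hV z hz).1
  have := Complex.differentiableOn_tsum_of_summable_norm
    (F := fun k z => qTerm q (s z) (w z) (a z) (b z) (d z) (e z) k)
    ((summable_geometric_of_lt_one hρ0.le hρ1).mul_left
      (Real.exp (M / ρ * (1 - ‖q‖)⁻¹) * Real.exp (M * (1 - ‖q‖)⁻¹) ^ 4 * K))
    (fun k => differentiable_qTerm hq k (hs.mono hVU) (hw.mono hVU) (ha.mono hVU) (hb.mono hVU)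
      (hd.mono hVU) (he.mono hVU)) hVo
    (fun k z hz => by
      obtain ⟨-, h2, h3, h4, h5, h6, h7⟩ := hV z hz
      exact norm_qTerm_le hq hρ0 hK h2 h3 h4 h5 h6 h7 k)
  exact (this.differentiableAt (hVo.mem_nhds hzV)).differentiableWithinAt

/-- The tool behind every series identity below: the partial sums of f are the values of G, so an
identity reduces to a rational check of one step and a limit of G. -/
lemma hasSum_of_telescoping {f G : ℕ → ℂ} {g : ℂ} (hf : Summable f) (h0 : f 0 = G 0)
    (hG : ∀ k, f (k + 1) = G (k + 1) - G k) (hlim : Tendsto G atTop (𝓝 g)) : HasSum f g := by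
  have h := (tendsto_add_atTop_iff_nat 1).mpr hf.hasSum.tendsto_sum_nat
  have hs : ∀ n, ∑ k ∈ Finset.range (n + 1), f k = G n := fun n => by
    rw [Finset.sum_range_succ', h0]
    simp_rw [hG]
    rw [Finset.sum_range_sub, sub_add_cancel]
  simp_rw [hs] at h
  rw [tendsto_nhds_unique hlim h]
  exact hf.hasSum

/-! ### The contiguous relation -/

lemma hasSum_phiSeriesReg (hq : ‖q‖ < 1) {z : ℂ} (hz : ‖z‖ < 1) (a b c d e : ℂ) :
    HasSum (fun k : ℕ => qPoch q a k * qPoch q b k * qPoch q c k / qPoch q q k *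
      (qPochInf q (d * q ^ k) * qPochInf q (e * q ^ k)) * z ^ k) (phiSeriesReg q a b c d e z) := by
  refine Summable.hasSum ?_
  convert summable_qTerm hq hz (z * a) b c d e using 1
  funext k
  rw [qTerm, prod_sub_mul_mul_pow]
  ring

/-- The rational certificate of the contiguous relation. -/
noncomputable def contigCert (q A B C D l p : ℂ) : ℂ :=
  (1 - 1 / A) * (1 - B * p) * (1 - C * p) + (1 - B * C * D * l * p) *
    ((1 / B + 1 / C - 1 / q) / (A * D * l) - 1 / D + (B * C / (D * q) - 1 / (A * D * l)) * p)

/-- This is the step of the telescoping with p = q^m, after the shifted factorials common to all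
terms of index m + 1 are divided out. The factors (1 - B)(1 - C) are missing on the left because
they are absorbed in (1 - b)(bq)_{m+1} = (b)_{m+2}. -/
lemma contigCert_step {q A B C D l : ℂ} (hq : q ≠ 0) (hA : A ≠ 0) (hB : B ≠ 0) (hC : C ≠ 0)
    (hD : D ≠ 0) (hl : l ≠ 0) (p : ℂ) :
    (1 - A) * (1 - D) * l * ((1 - B * p) * (1 - B * (q * p)) * ((1 - C * p) * (1 - C * (q * p))))
      - (l + q / (A * B * C * D * l) - (1 / A + 1 / B + 1 / C + 1 / D) + (1 + q) / q) *
        ((1 - B * p) * (1 - C * p) *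
          ((1 - B * C * D * l * (q * p)) * (1 - A * B * C * l * (q * p))))
      + q / (A * B * C * D * l) * ((1 - B / q) * (1 - C / q) *
        ((1 - B * C * D * l * p) * (1 - B * C * D * l * (q * p)) *
          ((1 - A * B * C * l * p) * (1 - A * B * C * l * (q * p)))))
      = contigCert q A B C D l (q * p) * ((1 - B * C * l * (q * p)) * (1 - B * p) * (1 - C * p)) *
          (A * D * l)
        - contigCert q A B C D l p * ((1 - q * p) *
          ((1 - B * C * D * l * (q * p)) * (1 - A * B * C * l * (q * p)))) := by
  unfold contigCert
  field_simp
  ring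

/-- The term of index 0 has no predecessor to subtract, so it must equal the certificate at p = 1 by
itself. -/
lemma contigCert_zero {q A B C D l : ℂ} (hq : q ≠ 0) (hA : A ≠ 0) (hB : B ≠ 0) (hC : C ≠ 0)
    (hD : D ≠ 0) (hl : l ≠ 0) :
    (1 - A) * (1 - B) * (1 - C) * (1 - D) * l
      - (l + q / (A * B * C * D * l) - (1 / A + 1 / B + 1 / C + 1 / D) + (1 + q) / q) *
        ((1 - B * C * D * l) * (1 - A * B * C * l))
      + q / (A * B * C * D * l) *
        ((1 - B * C * D * l / q) * (1 - B * C * D * l) *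
          ((1 - A * B * C * l / q) * (1 - A * B * C * l)))
      = contigCert q A B C D l 1 * (1 - B * C * l) * (A * D * l) := by
  unfold contigCert
  field_simp
  ring

lemma qPochInf_div_eq (hq0 : q ≠ 0) (hq : ‖q‖ < 1) (d : ℂ) :
    qPochInf q (d / q) = (1 - d / q) * (1 - d) * qPochInf q (d * q) := by
  rw [qPochInf_eq_mul hq, div_mul_cancel₀ _ hq0, qPochInf_eq_mul hq d, mul_assoc]

lemma contiguous_one (hq0 : q ≠ 0) (hq : ‖q‖ < 1) {A B C D l : ℂ} (hA : A ≠ 0) (hB : B ≠ 0)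
    (hC : C ≠ 0) (hD : D ≠ 0) (hl : l ≠ 0) (ht : ‖A * D * l‖ < 1) :
    (1 - A) * (1 - B) * (1 - C) * (1 - D) * l *
        phiSeriesReg q (B * C * l) (B * q) (C * q) (B * C * D * l * q) (A * B * C * l * q)
          (A * D * l)
      - (l + q / (A * B * C * D * l) - (1 / A + 1 / B + 1 / C + 1 / D) + (1 + q) / q) *
        phiSeriesReg q (B * C * l) B C (B * C * D * l) (A * B * C * l) (A * D * l)
      + q / (A * B * C * D * l) *
        phiSeriesReg q (B * C * l) (B / q) (C / q) (B * C * D * l / q) (A * B * C * l / q)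
          (A * D * l) = 0 := by
  have h1 := (hasSum_phiSeriesReg hq ht (B * C * l) (B * q) (C * q) (B * C * D * l * q)
    (A * B * C * l * q)).mul_left ((1 - A) * (1 - B) * (1 - C) * (1 - D) * l)
  have h0 := (hasSum_phiSeriesReg hq ht (B * C * l) B C (B * C * D * l)
    (A * B * C * l)).mul_left
    (l + q / (A * B * C * D * l) - (1 / A + 1 / B + 1 / C + 1 / D) + (1 + q) / q)
  have hm := (hasSum_phiSeriesReg hq ht (B * C * l) (B / q) (C / q) (B * C * D * l / q)
    (A * B * C * l / q)).mul_left (q / (A * B * C * D * l))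
  have hsum := (h1.sub h0).add hm
  let G : ℕ → ℂ := fun m =>
    contigCert q A B C D l (q ^ m) *
      (qPoch q (B * C * l) (m + 1) * qPoch q B m * qPoch q C m) * (qPoch q q m)⁻¹ *
      (qPochInf q (B * C * D * l * q ^ (m + 1)) * qPochInf q (A * B * C * l * q ^ (m + 1))) *
      (A * D * l) ^ (m + 1)
  refine hsum.unique (hasSum_of_telescoping (G := G) hsum.summable ?_ ?_ ?_)
  · simp only [G, pow_zero, qPoch_zero, mul_one, div_one, zero_add, pow_one, inv_one, one_mul,
      qPoch_succ]
    rw [qPochInf_div_eq hq0 hq, qPochInf_div_eq hq0 hq, qPochInf_eq_mul hq (B * C * D * l),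
      qPochInf_eq_mul hq (A * B * C * l)]
    linear_combination (qPochInf q (B * C * D * l * q) * qPochInf q (A * B * C * l * q)) *
      contigCert_zero hq0 hA hB hC hD hl
  · intro m
    have e1 : ∀ b : ℂ, (1 - b) * qPoch q (b * q) (m + 1) =
        qPoch q b m * ((1 - b * q ^ m) * (1 - b * (q * q ^ m))) := fun b => by
      rw [← qPoch_succ', qPoch_succ, qPoch_succ, pow_succ', mul_assoc]
    have e2 : ∀ b : ℂ, qPoch q (b / q) (m + 1) = (1 - b / q) * qPoch q b m := fun b => by
      rw [qPoch_succ', div_mul_cancel₀ _ hq0]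
    have e3 : ∀ d : ℂ, qPochInf q (d * q * q ^ (m + 1)) = qPochInf q (d * q ^ (m + 2)) :=
      fun d => by congr 1; ring
    have e4 : ∀ d : ℂ, qPochInf q (d * q ^ (m + 1)) =
        (1 - d * (q * q ^ m)) * qPochInf q (d * q ^ (m + 2)) := fun d => by
      rw [qPochInf_mul_pow_eq hq, pow_succ' q m]
    have e5 : ∀ d : ℂ, qPochInf q (d / q * q ^ (m + 1)) =
        (1 - d * q ^ m) * ((1 - d * (q * q ^ m)) * qPochInf q (d * q ^ (m + 2))) := fun d => by
      rw [← e4, ← qPochInf_mul_pow_eq hq]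
      congr 1
      field_simp
      ring
    have e7 : (1 - A) * (1 - B) * (1 - C) * (1 - D) * l *
        (qPoch q (B * C * l) (m + 1) * qPoch q (B * q) (m + 1) * qPoch q (C * q) (m + 1) /
          qPoch q q (m + 1) * (qPochInf q (B * C * D * l * q * q ^ (m + 1)) *
            qPochInf q (A * B * C * l * q * q ^ (m + 1))) * (A * D * l) ^ (m + 1)) =
        (1 - A) * (1 - D) * l * (qPoch q (B * C * l) (m + 1) *
          (qPoch q B m * ((1 - B * q ^ m) * (1 - B * (q * q ^ m)))) *
          (qPoch q C m * ((1 - C * q ^ m) * (1 - C * (q * q ^ m)))) *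
          (qPoch q q (m + 1))⁻¹ * (qPochInf q (B * C * D * l * q ^ (m + 2)) *
            qPochInf q (A * B * C * l * q ^ (m + 2))) * (A * D * l) ^ (m + 1)) := by
      rw [← e1, ← e1, e3, e3]
      ring
    simp only [G]
    rw [e7, e4, e4, e2, e2, e5, e5, qPoch_succ q _ (m + 1), qPoch_succ q B, qPoch_succ q C, inv_qPoch_self hq m,
      pow_succ (A * D * l) (m + 1), pow_succ' q m]
    linear_combination (qPoch q (B * C * l) (m + 1) * qPoch q B m * qPoch q C m *
      (qPoch q q (m + 1))⁻¹ * (qPochInf q (B * C * D * l * q ^ (m + 2)) *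
            qPochInf q (A * B * C * l * q ^ (m + 2))) * (A * D * l) ^ (m + 1)) *
      contigCert_step hq0 hA hB hC hD hl (q ^ m)
  · have t1 : Tendsto (fun m : ℕ => contigCert q A B C D l (q ^ m)) atTop
        (𝓝 (contigCert q A B C D l 0)) := by
      have : Continuous (contigCert q A B C D l) := by
        unfold contigCert
        fun_prop
      exact (this.tendsto 0).comp (tendsto_pow_zero hq)
    have t2 := ((tendsto_add_atTop_iff_nat 1).mpr (tendsto_qPoch hq (B * C * l))).mul
      (tendsto_qPoch hq B) |>.mul (tendsto_qPoch hq C)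
    have t3 := (tendsto_qPoch hq q).inv₀ (qPochInf_ne_zero_of_norm_lt_one hq hq)
    have t4 := ((tendsto_add_atTop_iff_nat 1).mpr
      (tendsto_qPochInf_mul_pow hq (B * C * D * l))).mul ((tendsto_add_atTop_iff_nat 1).mpr
      (tendsto_qPochInf_mul_pow hq (A * B * C * l)))
    have t5 := (tendsto_add_atTop_iff_nat 1).mpr (tendsto_pow_zero ht)
    have := (((t1.mul t2).mul t3).mul t4).mul t5
    rwa [mul_zero] at this

/-- The series `(BCDλ x, ABCλ x)_∞ ₃φ₂(BCλ, B x, C x; BCDλ x, ABCλ x; ADλ)`. -/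
noncomputable def solSeries (q A B C D l x : ℂ) : ℂ :=
  phiSeriesReg q (B * C * l) (B * x) (C * x) (B * C * D * l * x) (A * B * C * l * x) (A * D * l)

/-- Replacing A, B, C, D by Ax, Bx, Cx, Dx and l by l/x² leaves BCl and ADl fixed and multiplies
BCDl and ABCl by x. The general equation is therefore the case x = 1 rescaled. -/
lemma solSeries_contiguous (hq0 : q ≠ 0) (hq : ‖q‖ < 1) {A B C D l x : ℂ} (hA : A ≠ 0)
    (hB : B ≠ 0) (hC : C ≠ 0) (hD : D ≠ 0) (hl : l ≠ 0) (hx : x ≠ 0) (ht : ‖A * D * l‖ < 1) :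
    (1 - A * x) * (1 - B * x) * (1 - C * x) * (1 - D * x) * l * solSeries q A B C D l (x * q)
      - (l + q / (A * B * C * D * l) - (1 / A + 1 / B + 1 / C + 1 / D) * x + (1 + q) / q * x ^ 2) *
        solSeries q A B C D l x
      + q / (A * B * C * D * l) * solSeries q A B C D l (x / q) = 0 := by
  have e1 : A * x * (D * x) * (l / x ^ 2) = A * D * l := by field_simp
  have h := contiguous_one (A := A * x) (B := B * x) (C := C * x) (D := D * x) (l := l / x ^ 2)
    hq0 hq (by positivity) (by positivity) (by positivity) (by positivity) (by positivity)
    (by rwa [e1])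
  have e2 : B * x * (C * x) * (l / x ^ 2) = B * C * l := by field_simp
  have e3 : B * x * (C * x) * (D * x) * (l / x ^ 2) = B * C * D * l * x := by field_simp
  have e4 : A * x * (B * x) * (C * x) * (l / x ^ 2) = A * B * C * l * x := by field_simp
  rw [e1, e2, e3, e4] at h
  simp only [solSeries, ← mul_div_assoc, ← mul_assoc]
  set S1 := phiSeriesReg q (B * C * l) (B * x * q) (C * x * q) (B * C * D * l * x * q)
    (A * B * C * l * x * q) (A * D * l)
  set S0 := phiSeriesReg q (B * C * l) (B * x) (C * x) (B * C * D * l * x)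
    (A * B * C * l * x) (A * D * l)
  set S2 := phiSeriesReg q (B * C * l) (B * x / q) (C * x / q) (B * C * D * l * x / q)
    (A * B * C * l * x / q) (A * D * l)
  rw [← mul_zero (x ^ 2), ← h]
  field_simp

/-! ### Minimal solutions and convergence of the J-fraction -/

/-- Eventually the multiplier has modulus at most c < 1, so the recurrence is a contraction with
vanishing perturbation. -/
lemma tendsto_zero_of_linear_recurrence {y r ε : ℕ → ℂ} {ρ : ℂ} (hρ : ‖ρ‖ < 1)
    (hr : Tendsto r atTop (𝓝 ρ)) (hε : Tendsto ε atTop (𝓝 0))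
    (hy : ∀ᶠ n in atTop, y (n + 1) = r n * y n + ε n) : Tendsto y atTop (𝓝 0) := by
  obtain ⟨c, hc, hc1⟩ := exists_between hρ
  have hc0 : 0 ≤ c := (norm_nonneg ρ).trans hc.le
  rw [Metric.tendsto_nhds]
  intro δ hδ
  have h1 : ∀ᶠ n in atTop, ‖r n‖ ≤ c := (hr.norm.eventually_lt_const hc).mono fun n h => h.le
  have hε' : Tendsto (fun n => ‖ε n‖) atTop (𝓝 0) := by simpa using hε.norm
  have h2 : ∀ᶠ n in atTop, ‖ε n‖ ≤ (1 - c) * (δ / 2) :=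
    (hε'.eventually_lt_const (mul_pos (by linarith) (by linarith))).mono fun n h => h.le
  obtain ⟨N, hN⟩ := eventually_atTop.mp (h1.and (h2.and hy))
  have h3 : ∀ k, ‖y (N + k)‖ ≤ c ^ k * ‖y N‖ + δ / 2 := by
    intro k
    induction k with
    | zero => simp; linarith
    | succ k ih =>
      obtain ⟨g1, g2, g3⟩ := hN (N + k) (by omega)
      rw [← add_assoc, g3]
      calc ‖r (N + k) * y (N + k) + ε (N + k)‖
          ≤ ‖r (N + k)‖ * ‖y (N + k)‖ + ‖ε (N + k)‖ := (norm_add_le _ _).trans (by rw [norm_mul])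
        _ ≤ c * (c ^ k * ‖y N‖ + δ / 2) + (1 - c) * (δ / 2) := by gcongr
        _ = c ^ (k + 1) * ‖y N‖ + δ / 2 := by ring
  have h4 : Tendsto (fun k => c ^ k * ‖y N‖) atTop (𝓝 0) := by
    simpa using (tendsto_pow_atTop_nhds_zero_of_lt_one hc0 hc1).mul_const ‖y N‖
  obtain ⟨K, hK⟩ := eventually_atTop.mp (h4.eventually_lt_const (half_pos hδ))
  filter_upwards [eventually_ge_atTop (N + K)] with n hn
  obtain ⟨k, rfl⟩ := Nat.exists_eq_add_of_le (show N ≤ n by omega)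
  rw [dist_zero_right]
  have := hK k (by omega)
  have := h3 k
  linarith

lemma tendsto_of_linear_recurrence {x r w : ℕ → ℂ} {ρ W : ℂ} (hρ : ‖ρ‖ < 1)
    (hr : Tendsto r atTop (𝓝 ρ)) (hw : Tendsto w atTop (𝓝 W))
    (hx : ∀ᶠ n in atTop, x (n + 1) = r n * x n + w n) :
    Tendsto x atTop (𝓝 (W / (1 - ρ))) := by
  have hρ1 : 1 - ρ ≠ 0 := fun h => by
    rw [← sub_eq_zero.mp h, norm_one] at hρ
    exact lt_irrefl _ hρ
  have h := tendsto_zero_of_linear_recurrence (y := fun n => x n - W / (1 - ρ))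
    (ε := fun n => w n + r n * (W / (1 - ρ)) - W / (1 - ρ)) hρ hr ?_ ?_
  · simpa using h.add_const (W / (1 - ρ))
  · have := (hw.add (hr.mul_const (W / (1 - ρ)))).sub_const (W / (1 - ρ))
    convert this using 2
    field_simp
    ring
  · filter_upwards [hx] with n hn
    rw [hn]
    ring

lemma sphereQuot_mul_left {c : ℂ} (hc : c ≠ 0) (u v : ℂ) :
    sphereQuot (c * u) (c * v) = sphereQuot u v := by
  simp [sphereQuot, hc, mul_div_mul_left]

lemma tendsto_sphereQuot {ι : Type*} {f : Filter ι} {u v : ι → ℂ} {U V : ℂ}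
    (hu : Tendsto u f (𝓝 U)) (hv : Tendsto v f (𝓝 V)) (h : U ≠ 0 ∨ V ≠ 0) :
    Tendsto (fun i => sphereQuot (u i) (v i)) f (𝓝 (sphereQuot U V)) := by
  by_cases hV : V = 0
  · have hU : U ≠ 0 := h.resolve_right (not_not.mpr hV)
    subst hV
    rw [show sphereQuot U 0 = OnePoint.infty by simp [sphereQuot]]
    intro s hs
    rw [OnePoint.nhds_infty_eq, mem_sup, mem_map, mem_pure, coclosedCompact_eq_cocompact,
      ← Metric.cobounded_eq_cocompact] at hs
    obtain ⟨hs1, hs2⟩ := hs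
    -- Near ∞ it is the inverse quotient v/u, tending to 0, that is controlled; indices with v = 0
    -- give the point ∞ itself.
    have h1 := tendsto_inv₀_nhdsNE_zero (α := ℂ) hs1
    rw [mem_map, mem_nhdsWithin_iff_eventually] at h1
    have h2 : Tendsto (fun i => v i / u i) f (𝓝 0) := by
      have := hv.div hu hU
      rw [zero_div] at this
      exact this
    change ∀ᶠ i in f, sphereQuot (u i) (v i) ∈ s
    filter_upwards [h2.eventually h1, hu.eventually_ne hU] with i hi hui
    by_cases hvi : v i = 0
    · simpa [sphereQuot, hvi] using hs2
    · have := hi (div_ne_zero hvi hui)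
      simpa [sphereQuot, hvi] using this
  · rw [show sphereQuot U V = ((U / V : ℂ) : OnePoint ℂ) by simp [sphereQuot, hV]]
    refine ((OnePoint.continuous_coe.tendsto _).comp (hu.div hv hV)).congr' ?_
    filter_upwards [hv.eventually_ne hV] with i hi
    simp [sphereQuot, hi]

/-- The growth of an arbitrary solution of a three-term recurrence with constant-coefficient limit,
in terms of its Casoratian with the minimal solution. -/
lemma tendsto_div_pow_of_recurrence {a b p y κ : ℕ → ℂ} {lp lm y' K : ℂ} (hlp : lp ≠ 0)
    (hlm : lm ≠ 0) (hr : ‖lm / lp‖ < 1) (hy0 : y' ≠ 0) (hy : Tendsto y atTop (𝓝 y'))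
    (hκ0 : κ 0 = 1) (hκ : ∀ n, κ (n + 1) * (lp * lm) = κ n * b n) (hK : Tendsto κ atTop (𝓝 K))
    (hp : ∀ n, p (n + 2) = a n * p (n + 1) - b n * p n)
    (hY : ∀ n, lm ^ (n + 2) * y (n + 2) = a n * (lm ^ (n + 1) * y (n + 1)) - b n * (lm ^ n * y n)) :
    Tendsto (fun n => p n / lp ^ n) atTop
      (𝓝 (K / (lp * y') / (1 - lm / lp) * (p 1 * y 0 - p 0 * (lm * y 1)))) := by
  -- The Casoratian is multiplied by b n at each step, and `hκ` says that the product of these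
  -- factors is (lp lm)^n κ n.
  have hW : ∀ n, p (n + 1) * (lm ^ n * y n) - p n * (lm ^ (n + 1) * y (n + 1)) =
      (lp * lm) ^ n * κ n * (p 1 * y 0 - p 0 * (lm * y 1)) := by
    intro n
    induction n with
    | zero => simp [hκ0]
    | succ n ih =>
      rw [hp, hY]
      linear_combination b n * ih - (lp * lm) ^ n * (p 1 * y 0 - p 0 * (lm * y 1)) * hκ n
  set W := p 1 * y 0 - p 0 * (lm * y 1) with hWdef
  have hy1 := (tendsto_add_atTop_iff_nat 1).mpr hy
  -- Solving the Casoratian identity for p (n + 1) gives a first-order recurrence for p n / lp^n.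
  -- Its multiplier tends to lm / lp because y has a nonzero limit.
  have h := tendsto_of_linear_recurrence (x := fun n => p n / lp ^ n)
    (r := fun n => lm / lp * (y (n + 1) / y n)) (w := fun n => κ n * W / (lp * y n)) (ρ := lm / lp)
    (W := K * W / (lp * y')) hr ?_ ?_ ?_
  · convert h using 2
    ring
  · simpa [div_self hy0] using (hy1.div hy hy0).const_mul (lm / lp)
  · exact (hK.mul_const W).div (hy.const_mul lp) (mul_ne_zero hlp hy0)
  · filter_upwards [hy.eventually_ne hy0] with n hn
    have e := hW n
    have e1 : p (n + 1) * y n - lm * p n * y (n + 1) = lp ^ n * (κ n * W) := by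
      have hlmn : lm ^ n ≠ 0 := pow_ne_zero _ hlm
      refine mul_left_cancel₀ hlmn ?_
      rw [mul_pow] at e
      linear_combination e
    have hlpn : lp ^ n ≠ 0 := pow_ne_zero _ hlp
    rw [pow_succ]
    field_simp
    linear_combination e1

/-- Two consecutive zeros would propagate through the recurrence and contradict the nonzero limit.
This excludes the quotient 0/0 below. -/
lemma ne_zero_or_ne_zero_of_recurrence {a b y : ℕ → ℂ} {lm y' : ℂ} (hlm : lm ≠ 0) (hy0 : y' ≠ 0)
    (hy : Tendsto y atTop (𝓝 y'))
    (hY : ∀ n, lm ^ (n + 2) * y (n + 2) = a n * (lm ^ (n + 1) * y (n + 1)) - b n * (lm ^ n * y n)) :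
    y 0 ≠ 0 ∨ y 1 ≠ 0 := by
  by_contra! h
  have h0 : ∀ n, y n = 0 ∧ y (n + 1) = 0 := by
    intro n
    induction n with
    | zero => exact h
    | succ n ih =>
      refine ⟨ih.2, ?_⟩
      have := hY n
      rw [ih.1, ih.2] at this
      simpa [hlm] using this
  refine hy0 (tendsto_nhds_unique hy ?_)
  simp [show y = fun _ => 0 from funext fun n => (h0 n).1]

lemma jFraction_nums_succ_succ (q A B C D z : ℂ) (n : ℕ) :
    (jFraction q A B C D z).nums (n + 2) =
      (z - coeffA q A B C D (n + 2 : ℕ)) * (jFraction q A B C D z).nums (n + 1) -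
        coeffBsq q A B C D (n + 2 : ℕ) * (jFraction q A B C D z).nums n := by
  rw [GenContFract.nums_recurrence (g := jFraction q A B C D z) (n := n)
    (gp := { a := -coeffBsq q A B C D (((n + 1 : ℕ) : ℤ) + 1),
             b := z - coeffA q A B C D (((n + 1 : ℕ) : ℤ) + 1) }) rfl rfl rfl]
  push_cast
  rw [add_assoc]
  norm_num
  ring

lemma jFraction_dens_succ_succ (q A B C D z : ℂ) (n : ℕ) :
    (jFraction q A B C D z).dens (n + 2) =
      (z - coeffA q A B C D (n + 2 : ℕ)) * (jFraction q A B C D z).dens (n + 1) -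
        coeffBsq q A B C D (n + 2 : ℕ) * (jFraction q A B C D z).dens n := by
  rw [GenContFract.dens_recurrence (g := jFraction q A B C D z) (n := n)
    (gp := { a := -coeffBsq q A B C D (((n + 1 : ℕ) : ℤ) + 1),
             b := z - coeffA q A B C D (((n + 1 : ℕ) : ℤ) + 1) }) rfl rfl rfl]
  push_cast
  rw [add_assoc]
  norm_num
  ring

/-- The numerators of the convergents, started one step earlier. -/
noncomputable def shiftNums (q A B C D z : ℂ) : ℕ → ℂ
  | 0 => 1
  | n + 1 => (jFraction q A B C D z).nums n

/-- The denominators of the convergents, started one step earlier. -/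
noncomputable def shiftDens (q A B C D z : ℂ) : ℕ → ℂ
  | 0 => 0
  | n + 1 => (jFraction q A B C D z).dens n

lemma shiftNums_recurrence (q A B C D z : ℂ) (n : ℕ) :
    shiftNums q A B C D z (n + 2) = (z - coeffA q A B C D (n + 1 : ℕ)) *
      shiftNums q A B C D z (n + 1) - coeffBsq q A B C D (n + 1 : ℕ) * shiftNums q A B C D z n := by
  cases n with
  | zero =>
    simp only [shiftNums, zero_add]
    rw [GenContFract.first_num_eq (g := jFraction q A B C D z)
      (gp := { a := -coeffBsq q A B C D (((0 : ℕ) : ℤ) + 1),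
               b := z - coeffA q A B C D (((0 : ℕ) : ℤ) + 1) }) rfl,
      GenContFract.zeroth_num_eq_h]
    push_cast
    norm_num
    ring
  | succ n => exact jFraction_nums_succ_succ q A B C D z n

lemma shiftDens_recurrence (q A B C D z : ℂ) (n : ℕ) :
    shiftDens q A B C D z (n + 2) = (z - coeffA q A B C D (n + 1 : ℕ)) *
      shiftDens q A B C D z (n + 1) - coeffBsq q A B C D (n + 1 : ℕ) * shiftDens q A B C D z n := by
  cases n with
  | zero =>
    simp only [shiftDens, zero_add]
    rw [GenContFract.first_den_eq (g := jFraction q A B C D z)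
      (gp := { a := -coeffBsq q A B C D (((0 : ℕ) : ℤ) + 1),
               b := z - coeffA q A B C D (((0 : ℕ) : ℤ) + 1) }) rfl,
      GenContFract.zeroth_den_eq_one]
    push_cast
    norm_num
  | succ n => exact jFraction_dens_succ_succ q A B C D z n

/-! ### Nonvanishing of the limit of the minimal solution -/

lemma phiSeriesReg_zero_right (q a b c : ℂ) : phiSeriesReg q a b c 0 0 0 = 1 := by
  unfold phiSeriesReg
  rw [tsum_eq_single 0 fun k hk => by simp [hk]]
  simp

/-- The functional equation behind the q-binomial theorem, for the ₁φ₀ series obtained when the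
other parameters are 0. -/
lemma phiSeriesReg_binomial_step (hq : ‖q‖ < 1) (a : ℂ) {t : ℂ} (ht : ‖t‖ < 1) :
    (1 - t) * phiSeriesReg q a 0 0 0 0 t = (1 - a * t) * phiSeriesReg q a 0 0 0 0 (t * q) := by
  have htq : ‖t * q‖ < 1 := by
    rw [norm_mul]
    exact mul_lt_one_of_nonneg_of_lt_one_left (norm_nonneg _) ht hq.le
  have h := ((hasSum_phiSeriesReg hq ht a 0 0 0 0).mul_left (1 - t)).sub
    ((hasSum_phiSeriesReg hq htq a 0 0 0 0).mul_left (1 - a * t))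
  rw [← sub_eq_zero]
  refine h.unique (hasSum_of_telescoping
    (G := fun m => -(qPoch q a (m + 1) * (qPoch q q m)⁻¹ * t ^ (m + 1))) h.summable ?_ ?_ ?_)
  · simp [qPoch_succ]
    ring
  · intro m
    simp only [qPoch_zero_left, zero_mul, qPochInf_zero, mul_one, mul_pow]
    rw [inv_qPoch_self hq m, qPoch_succ q a (m + 1)]
    ring
  · have t3 := (tendsto_qPoch hq q).inv₀ (qPochInf_ne_zero_of_norm_lt_one hq hq)
    have := ((((tendsto_add_atTop_iff_nat 1).mpr (tendsto_qPoch hq a)).mul t3).mul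
      ((tendsto_add_atTop_iff_nat 1).mpr (tendsto_pow_zero ht))).neg
    simpa using this

/-- A zero at t would pass to every t q^n, since 1 - a t q^n ≠ 0, and by continuity to 0, where the
series is 1. -/
lemma phiSeriesReg_binomial_ne_zero (hq : ‖q‖ < 1) {a t : ℂ} (ht : ‖t‖ < 1)
    (hat : ‖a * t‖ < 1) : phiSeriesReg q a 0 0 0 0 t ≠ 0 := by
  intro h
  have hz : ∀ n : ℕ, phiSeriesReg q a 0 0 0 0 (t * q ^ n) = 0 := by
    intro n
    induction n with
    | zero => simpa using h
    | succ n ih =>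
      have h1 := phiSeriesReg_binomial_step hq a
        ((norm_mul_pow_le hq le_rfl n).trans_lt ht)
      rw [ih, mul_zero, eq_comm, mul_eq_zero] at h1
      rcases h1 with h1 | h1
      · exact absurd (show a * t * q ^ n = 1 by linear_combination -h1)
          (notQPole_of_norm_lt_one hq hat n)
      · rw [pow_succ, ← mul_assoc, h1]
  have hd := differentiableOn_qSeries hq (U := Metric.ball 0 1) Metric.isOpen_ball
    (s := fun z => z * a) (w := fun z => z) (a := fun _ => 0) (b := fun _ => 0) (d := fun _ => 0)
    (e := fun _ => 0) (fun z hz => by simpa using hz) (by fun_prop) (by fun_prop) (by fun_prop)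
    (by fun_prop) (by fun_prop) (by fun_prop)
  have hc := hd.continuousOn.continuousAt (Metric.ball_mem_nhds 0 one_pos)
  have h1 : Tendsto (fun n : ℕ => t * q ^ n) atTop (𝓝 0) := by
    simpa using (tendsto_pow_zero hq).const_mul t
  have h2 := hc.tendsto.comp h1
  simp only [← phiSeriesReg_eq_qSeries, Function.comp_def, hz] at h2
  rw [phiSeriesReg_zero_right] at h2
  exact zero_ne_one (tendsto_nhds_unique tendsto_const_nhds h2)

/-- Continuity in x at 0: all parameters proportional to x disappear and a ₁φ₀ remains. -/
lemma tendsto_solSeries (hq : ‖q‖ < 1) {A B C D l : ℂ} (ht : ‖A * D * l‖ < 1) :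
    Tendsto (fun n : ℕ => solSeries q A B C D l (q ^ n)) atTop
      (𝓝 (phiSeriesReg q (B * C * l) 0 0 0 0 (A * D * l))) := by
  have hd := differentiableOn_qSeries hq (U := Set.univ) isOpen_univ
    (s := fun _ => A * D * l * (B * C * l)) (w := fun _ => A * D * l) (a := fun x => B * x)
    (b := fun x => C * x) (d := fun x => B * C * D * l * x) (e := fun x => A * B * C * l * x)
    (fun z _ => ht) (by fun_prop) (by fun_prop) (by fun_prop)
    (by fun_prop) (by fun_prop) (by fun_prop)
  have hc := hd.continuousOn.continuousAt (x := 0) univ_mem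
  have h2 := hc.tendsto.comp (tendsto_pow_zero hq)
  simp only [← phiSeriesReg_eq_qSeries, mul_zero] at h2
  exact h2

/-! ### The limit of the convergents -/

lemma coeffBsq_succ (q A B C D : ℂ) (n : ℕ) :
    coeffBsq q A B C D (n + 1 : ℕ) = q / (A * B * C * D) *
      ((1 - A * q ^ n) * (1 - B * q ^ n) * (1 - C * q ^ n) * (1 - D * q ^ n)) := by
  simp only [coeffBsq, Nat.cast_add, Nat.cast_one, add_sub_cancel_right, zpow_natCast]
  ring

lemma coeffA_natCast (hq0 : q ≠ 0) (A B C D : ℂ) (n : ℕ) :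
    coeffA q A B C D n =
      (1 / A + 1 / B + 1 / C + 1 / D) * q ^ n - (1 + q) / q * (q ^ n) ^ 2 := by
  have : q ^ (2 * (n : ℤ) - 1) = (q ^ n) ^ 2 / q := by
    rw [zpow_sub₀ hq0, zpow_one, mul_comm, zpow_mul, zpow_natCast]
    norm_cast
  rw [coeffA, this, zpow_natCast]
  ring

/-- Pincherle's theorem for the explicit solution l^n y n. Numerators and denominators have the same
growth constant, so only the initial Casoratians remain in the quotient. -/
lemma tendsto_recipConvergent (hq0 : q ≠ 0) (hq : ‖q‖ < 1) {A B C D l lp : ℂ} (hA : A ≠ 0)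
    (hB : B ≠ 0) (hC : C ≠ 0) (hD : D ≠ 0) (nA : NotQPole q A) (nB : NotQPole q B)
    (nC : NotQPole q C) (nD : NotQPole q D) (hl : l ≠ 0) (hlp : lp = q / (A * B * C * D * l))
    (hr : ‖l / lp‖ < 1) (ht : ‖A * D * l‖ < 1) :
    (solSeries q A B C D l 1 ≠ 0 ∨ lp * solSeries q A B C D l (1 / q) ≠ 0) ∧
    Tendsto (recipConvergent q A B C D (lp + l)) atTop
      (𝓝 (sphereQuot (solSeries q A B C D l 1) (lp * solSeries q A B C D l (1 / q)))) := by
  have hlp0 : lp ≠ 0 := by rw [hlp]; positivity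
  have hprod : lp * l = q / (A * B * C * D) := by rw [hlp]; field_simp
  set F := solSeries q A B C D l with hF
  set κ : ℕ → ℂ := fun n => qPoch q A n * qPoch q B n * qPoch q C n * qPoch q D n with hκ
  set K := qPochInf q A * qPochInf q B * qPochInf q C * qPochInf q D with hKdef
  have hK0 : K ≠ 0 := mul_ne_zero (mul_ne_zero (mul_ne_zero (qPochInf_ne_zero hq nA)
    (qPochInf_ne_zero hq nB)) (qPochInf_ne_zero hq nC)) (qPochInf_ne_zero hq nD)
  have hK : Tendsto κ atTop (𝓝 K) := (((tendsto_qPoch hq A).mul (tendsto_qPoch hq B)).mul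
    (tendsto_qPoch hq C)).mul (tendsto_qPoch hq D)
  set f := phiSeriesReg q (B * C * l) 0 0 0 0 (A * D * l)
  have hf0 : f ≠ 0 := by
    refine phiSeriesReg_binomial_ne_zero hq ht ?_
    have : B * C * l * (A * D * l) = q * (l / lp) := by rw [hlp]; field_simp
    rw [this, norm_mul]
    exact mul_lt_one_of_nonneg_of_lt_one_left (norm_nonneg _) hq hr.le
  set y : ℕ → ℂ := fun n => κ n * F (q ^ n) with hydef
  have hy : Tendsto y atTop (𝓝 (K * f)) := hK.mul (tendsto_solSeries hq ht)
  have hcont : ∀ x : ℂ, x ≠ 0 → (1 - A * x) * (1 - B * x) * (1 - C * x) * (1 - D * x) * l *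
      F (x * q) = (lp + l - ((1 / A + 1 / B + 1 / C + 1 / D) * x - (1 + q) / q * x ^ 2)) * F x
        - lp * F (x / q) := fun x hx => by
    have := solSeries_contiguous hq0 hq hA hB hC hD hl hx ht
    rw [← hlp] at this
    linear_combination this
  have hκs : ∀ n, κ (n + 1) =
      κ n * ((1 - A * q ^ n) * (1 - B * q ^ n) * (1 - C * q ^ n) * (1 - D * q ^ n)) := fun n => by
    simp only [hκ, qPoch_succ]
    ring
  have hY : ∀ n : ℕ, l ^ (n + 2) * y (n + 2) =
      (lp + l - coeffA q A B C D (n + 1 : ℕ)) * (l ^ (n + 1) * y (n + 1)) -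
        coeffBsq q A B C D (n + 1 : ℕ) * (l ^ n * y n) := by
    intro n
    have h := hcont (q ^ (n + 1)) (pow_ne_zero _ hq0)
    rw [← pow_succ, show q ^ (n + 1) / q = q ^ n by rw [pow_succ, mul_div_cancel_right₀ _ hq0]]
      at h
    rw [coeffA_natCast hq0, coeffBsq_succ, ← hprod]
    simp only [hydef]
    rw [hκs (n + 1), hκs n]
    linear_combination l ^ (n + 1) * (κ n *
      ((1 - A * q ^ n) * (1 - B * q ^ n) * (1 - C * q ^ n) * (1 - D * q ^ n))) * h
  have hκb : ∀ n, κ (n + 1) * (lp * l) = κ n * coeffBsq q A B C D (n + 1 : ℕ) := fun n => by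
    rw [hκs, coeffBsq_succ, hprod]
    ring
  have hκ0 : κ 0 = 1 := by simp [hκ]
  have hy0 : y 0 = F 1 := by simp [hydef, hκ0]
  have hN := tendsto_div_pow_of_recurrence hlp0 hl hr (mul_ne_zero hK0 hf0) hy hκ0 hκb hK
    (shiftNums_recurrence q A B C D (lp + l)) hY
  have hDn := tendsto_div_pow_of_recurrence hlp0 hl hr (mul_ne_zero hK0 hf0) hy hκ0 hκb hK
    (shiftDens_recurrence q A B C D (lp + l)) hY
  -- This is the q-difference equation at x = 1, where F(1/q) supplies the value of the solution
  -- before index 0.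
  have hWN : shiftNums q A B C D (lp + l) 1 * y 0 -
      shiftNums q A B C D (lp + l) 0 * (l * y 1) = lp * F (1 / q) := by
    have h := hcont 1 one_ne_zero
    have hA0 := coeffA_natCast hq0 A B C D 0
    have hh : (jFraction q A B C D (lp + l)).h = lp + l - coeffA q A B C D (0 : ℕ) := rfl
    simp only [shiftNums, GenContFract.zeroth_num_eq_h]
    have hy1 : y 1 = (1 - A * 1) * (1 - B * 1) * (1 - C * 1) * (1 - D * 1) * F (1 * q) := by
      simp [hydef, hκ, qPoch_succ]
    rw [hh, hA0, hy0, hy1, pow_zero]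
    linear_combination -h
  have hWD : shiftDens q A B C D (lp + l) 1 * y 0 -
      shiftDens q A B C D (lp + l) 0 * (l * y 1) = F 1 := by
    simp [shiftDens, hy0]
  rw [hWN] at hN
  rw [hWD] at hDn
  have hne : F 1 ≠ 0 ∨ lp * F (1 / q) ≠ 0 := by
    by_contra! h
    have hy1 : y 1 = 0 := by
      rw [h.2] at hWN
      rw [hy0, h.1] at hWN
      simpa [shiftNums, hl] using hWN
    rcases ne_zero_or_ne_zero_of_recurrence hl (mul_ne_zero hK0 hf0) hy hY with h1 | h1
    · exact h1 (hy0.trans h.1)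
    · exact h1 hy1
  refine ⟨hne, ?_⟩
  have hr1 : (1 : ℂ) - l / lp ≠ 0 := fun h => by
    rw [← sub_eq_zero.mp h, norm_one] at hr
    exact lt_irrefl _ hr
  -- The constant shared by both limits; being nonzero, it cancels on the sphere, as does the
  -- scaling by lp^n.
  set c := K / (lp * (K * f)) / (1 - l / lp) with hc
  have hc0 : c ≠ 0 := div_ne_zero (div_ne_zero hK0 (mul_ne_zero hlp0 (mul_ne_zero hK0 hf0))) hr1
  have := tendsto_sphereQuot ((tendsto_add_atTop_iff_nat 1).mpr hDn)
    ((tendsto_add_atTop_iff_nat 1).mpr hN) (by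
      rcases hne with h | h
      · exact Or.inl (mul_ne_zero hc0 h)
      · exact Or.inr (mul_ne_zero hc0 h))
  rw [sphereQuot_mul_left hc0] at this
  refine this.congr fun n => ?_
  simp only [shiftNums, shiftDens, recipConvergent, div_eq_inv_mul]
  exact sphereQuot_mul_left (inv_ne_zero (pow_ne_zero _ hlp0)) _ _

/-! ### The `q`-Gauss sum -/

/-- The zero parameters reduce the series to a ₂φ₁ whose lower parameter abt moves with t. Iteration
drives t to 0, where the series is 1, and produces the q-Gauss product. -/
lemma qGauss_step (hq : ‖q‖ < 1) (a b : ℂ) {t : ℂ} (ht : ‖t‖ < 1) :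
    (1 - t) * phiSeriesReg q a b 0 (a * b * t) 0 t =
      (1 - a * t) * (1 - b * t) * phiSeriesReg q a b 0 (a * b * (t * q)) 0 (t * q) := by
  have htq : ‖t * q‖ < 1 := by
    rw [norm_mul]
    exact mul_lt_one_of_nonneg_of_lt_one_left (norm_nonneg _) ht hq.le
  have h := ((hasSum_phiSeriesReg hq ht a b 0 (a * b * t) 0).mul_left (1 - t)).sub
    ((hasSum_phiSeriesReg hq htq a b 0 (a * b * (t * q)) 0).mul_left ((1 - a * t) * (1 - b * t)))
  rw [← sub_eq_zero]
  refine h.unique (hasSum_of_telescoping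
    (G := fun m => -(qPoch q a (m + 1) * qPoch q b (m + 1) * (qPoch q q m)⁻¹ *
      qPochInf q (a * b * t * q ^ (m + 1)) * t ^ (m + 1))) h.summable ?_ ?_ ?_)
  · simp only [pow_zero, qPoch_zero, mul_one, div_one, zero_add, pow_one, qPoch_succ,
      qPochInf_zero, inv_one, one_mul]
    rw [qPochInf_eq_mul hq (a * b * t), mul_assoc (a * b) t q]
    ring
  · intro m
    have e3 : qPochInf q (a * b * (t * q) * q ^ (m + 1)) =
      qPochInf q (a * b * t * q ^ (m + 2)) := by congr 1; ring
    simp only [qPoch_zero_left, zero_mul, qPochInf_zero, mul_one, mul_pow t q]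
    rw [inv_qPoch_self hq m, qPoch_succ q a (m + 1), qPoch_succ q b (m + 1), e3,
      qPochInf_mul_pow_succ_eq hq]
    ring
  · have t3 := (tendsto_qPoch hq q).inv₀ (qPochInf_ne_zero_of_norm_lt_one hq hq)
    have := (((((tendsto_add_atTop_iff_nat 1).mpr (tendsto_qPoch hq a)).mul
      ((tendsto_add_atTop_iff_nat 1).mpr (tendsto_qPoch hq b))).mul t3).mul
      ((tendsto_add_atTop_iff_nat 1).mpr (tendsto_qPochInf_mul_pow hq (a * b * t)))).mul
      ((tendsto_add_atTop_iff_nat 1).mpr (tendsto_pow_zero ht))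
    simpa using this.neg

/-- The `q`-Gauss sum. -/
lemma qGauss (hq : ‖q‖ < 1) (a b : ℂ) {t : ℂ} (ht : ‖t‖ < 1) :
    qPochInf q t * phiSeriesReg q a b 0 (a * b * t) 0 t =
      qPochInf q (a * t) * qPochInf q (b * t) := by
  set S : ℂ → ℂ := fun t => phiSeriesReg q a b 0 (a * b * t) 0 t with hS
  have hn : ∀ n, qPoch q t n * S t = qPoch q (a * t) n * qPoch q (b * t) n * S (t * q ^ n) := by
    intro n
    induction n with
    | zero => simp
    | succ n ih =>
      have h := qGauss_step hq a b ((norm_mul_pow_le hq le_rfl n).trans_lt ht)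
      rw [mul_assoc t, ← pow_succ] at h
      simp only [qPoch_succ]
      have e : qPoch q t n * (1 - t * q ^ n) * S t =
        (1 - t * q ^ n) * (qPoch q t n * S t) := by ring
      rw [e, ih]
      linear_combination qPoch q (a * t) n * qPoch q (b * t) n * h
  have hd := differentiableOn_qSeries hq (U := Metric.ball 0 1) Metric.isOpen_ball
    (s := fun z => z * a) (w := fun z => z) (a := fun _ => b) (b := fun _ => 0)
    (d := fun z => a * b * z) (e := fun _ => 0) (fun z hz => by simpa using hz) (by fun_prop)
    (by fun_prop) (by fun_prop) (by fun_prop) (by fun_prop) (by fun_prop)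
  have hc := hd.continuousOn.continuousAt (Metric.ball_mem_nhds 0 one_pos)
  have h1 : Tendsto (fun n : ℕ => t * q ^ n) atTop (𝓝 0) := by
    simpa using (tendsto_pow_zero hq).const_mul t
  have h2 := hc.tendsto.comp h1
  simp only [← phiSeriesReg_eq_qSeries, mul_zero] at h2
  rw [phiSeriesReg_zero_right] at h2
  have h3 := ((tendsto_qPoch hq (a * t)).mul (tendsto_qPoch hq (b * t))).mul h2
  rw [mul_one] at h3
  refine tendsto_nhds_unique ((tendsto_qPoch hq t).mul_const (S t)) (h3.congr fun n => ?_)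
  exact (hn n).symm

lemma phiSeriesReg_cancel (hq : ‖q‖ < 1) (a b c e z : ℂ) :
    phiSeriesReg q a b c a e z = qPochInf q a * phiSeriesReg q b c 0 e 0 z := by
  unfold phiSeriesReg
  rw [← tsum_mul_left]
  refine tsum_congr fun k => ?_
  rw [← qPoch_mul_qPochInf hq a k]
  simp
  ring

lemma phiSeriesReg_rotate (q a b c d e z : ℂ) :
    phiSeriesReg q a b c d e z = phiSeriesReg q c a b e d z := by
  unfold phiSeriesReg
  exact tsum_congr fun k => by ring

lemma phiSeriesReg_one_right (q a b d e z : ℂ) :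
    phiSeriesReg q a b 1 d e z = qPochInf q d * qPochInf q e := by
  unfold phiSeriesReg
  rw [tsum_eq_single 0 fun k hk => ?_]
  · simp
  · obtain ⟨m, rfl⟩ := Nat.exists_eq_succ_of_ne_zero hk
    simp [qPoch_one_succ]

/-- For C = q and x = 1/q a numerator parameter is 1, so only the term of index 0 survives. -/
lemma solSeries_inv_of_eq_self (hq0 : q ≠ 0) (A B D l : ℂ) :
    solSeries q A B q D l (1 / q) = qPochInf q (B * D * l) * qPochInf q (A * B * l) := by
  have e1 : q * (1 / q) = 1 := by field_simp
  have e2 : B * q * D * l * (1 / q) = B * D * l := by field_simp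
  have e3 : A * B * q * l * (1 / q) = A * B * l := by field_simp
  rw [solSeries, e1, e2, e3, phiSeriesReg_one_right]

/-- Here DAl occurs both as a numerator and as a lower parameter; cancelling it leaves a ₂φ₁ of
q-Gauss type. -/
lemma solSeries_perm_inv_of_eq_self (hq0 : q ≠ 0) (hq : ‖q‖ < 1) {A B D l : ℂ}
    (ht : ‖B * q * l‖ < 1) :
    qPochInf q (B * q * l) * solSeries q B D A q l (1 / q) =
      qPochInf q (A * D * l) * (qPochInf q (B * D * l) * qPochInf q (A * B * l)) := by
  have e2 : D * A * q * l * (1 / q) = D * A * l := by field_simp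
  have e3 : B * D * A * l * (1 / q) = D * (1 / q) * (A * (1 / q)) * (B * q * l) := by field_simp
  rw [solSeries, e2, e3, phiSeriesReg_cancel hq, mul_left_comm, qGauss hq _ _ ht, mul_comm D A]
  congr 3 <;> field_simp

/-! ### The transformation to argument `q` -/

lemma tendsto_prod_sub_mul_pow (hq : ‖q‖ < 1) {w : ℂ} (hw : ‖w‖ < 1) (n : ℂ) :
    Tendsto (fun m : ℕ => ∏ j ∈ Finset.range m, (w - n * q ^ j)) atTop (𝓝 0) := by
  obtain ⟨ρ, hρ, hρ1⟩ := exists_between hw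
  have hρ0 : 0 < ρ := (norm_nonneg _).trans_lt hρ
  refine squeeze_zero_norm (norm_prod_sub_mul_pow_le hq hρ0 hρ.le le_rfl) ?_
  simpa using (tendsto_pow_atTop_nhds_zero_of_lt_one hρ0.le hρ1).mul_const _

lemma qTerm_self_right (hq : ‖q‖ < 1) (s w a d e : ℂ) (k : ℕ) :
    qTerm q s w a q d e k = (∏ j ∈ Finset.range k, (w - s * q ^ j)) * qPoch q a k *
      (qPochInf q (d * q ^ k) * qPochInf q (e * q ^ k)) := by
  unfold qTerm
  field_simp [qPoch_self_ne_zero hq k]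

/-- A first-order q-difference equation in w with n fixed. The inhomogeneous term is the constant
part of the telescoping sequence; the rest of that sequence vanishes because the products of w - n
q^j tend to 0. -/
lemma qSeries_shift (hq : ‖q‖ < 1) {u v B n w : ℂ} (hB : B ≠ 0) (hn : n * B = q * u * v)
    (hw : ‖w‖ < 1) :
    (u * v - w * B) * ((1 - w) * qSeries q n w B q (u * q) (v * q)) -
      (u - w * B) * (v - w * B) * qSeries q n (w * q) B q (u * q) (v * q) =
      -(w * B * (qPochInf q u * qPochInf q v)) := by
  have hwq : ‖w * q‖ < 1 := by
    rw [norm_mul]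
    exact mul_lt_one_of_nonneg_of_lt_one_left (norm_nonneg _) hw hq.le
  have h1 : HasSum _ (qSeries q n w B q (u * q) (v * q)) :=
    (summable_qTerm hq hw n B q (u * q) (v * q)).hasSum
  have h2 : HasSum _ (qSeries q n (w * q) B q (u * q) (v * q)) :=
    (summable_qTerm hq hwq n B q (u * q) (v * q)).hasSum
  have h := ((h1.mul_left (1 - w)).mul_left (u * v - w * B)).sub
    (h2.mul_left ((u - w * B) * (v - w * B)))
  simp only [qTerm_self_right hq] at h
  refine h.unique (hasSum_of_telescoping
    (G := fun m => -(w * B * (qPochInf q u * qPochInf q v)) - (u * v - w * B) * w *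
      ((∏ j ∈ Finset.range m, (w - n * q ^ j)) * (qPoch q B (m + 1) *
        (qPochInf q (u * q ^ (m + 1)) * qPochInf q (v * q ^ (m + 1)))))) h.summable ?_ ?_ ?_)
  · simp only [pow_zero, qPoch_zero, mul_one, Finset.range_zero, Finset.prod_empty, one_mul,
      zero_add, qPoch_succ, pow_one]
    rw [qPochInf_eq_mul hq u, qPochInf_eq_mul hq v]
    ring
  · intro m
    have e1 : ∀ d : ℂ, d * q * q ^ (m + 1) = d * q ^ (m + 2) := fun d => by ring
    have e2 : ∏ j ∈ Finset.range (m + 1), (w * q - n * q ^ j) =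
        (w * q - n) * (q ^ m * ∏ j ∈ Finset.range m, (w - n * q ^ j)) := by
      rw [Finset.prod_range_succ', mul_comm]
      have : q ^ m = ∏ _j ∈ Finset.range m, q := by simp
      rw [this, ← Finset.prod_mul_distrib]
      congr 1
      · simp
      · exact Finset.prod_congr rfl fun j _ => by ring
    rw [e2]
    simp only [e1]
    rw [qPoch_succ q B (m + 1), qPoch_succ q B m, qPochInf_mul_pow_succ_eq hq u m,
      qPochInf_mul_pow_succ_eq hq v m, Finset.prod_range_succ]
    have key : (u * v - w * B) * (1 - w) * (w - n * q ^ m) -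
        (u - w * B) * (v - w * B) * ((w * q - n) * q ^ m) =
        -((u * v - w * B) * w) * ((w - n * q ^ m) * (1 - B * q ^ (m + 1)) -
          (1 - u * (q * q ^ m)) * (1 - v * (q * q ^ m))) := by
      have hn' : n = q * u * v / B := by rw [← hn]; field_simp
      rw [hn', pow_succ]
      field_simp
      ring
    linear_combination ((∏ j ∈ Finset.range m, (w - n * q ^ j)) * (qPoch q B m *
      (1 - B * q ^ m)) * (qPochInf q (u * q ^ (m + 2)) * qPochInf q (v * q ^ (m + 2)))) * key
  · have := (tendsto_prod_sub_mul_pow hq hw n).mul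
      (((tendsto_add_atTop_iff_nat 1).mpr (tendsto_qPoch hq B)).mul
        (((tendsto_add_atTop_iff_nat 1).mpr (tendsto_qPochInf_mul_pow hq u)).mul
        ((tendsto_add_atTop_iff_nat 1).mpr (tendsto_qPochInf_mul_pow hq v))))
    rw [zero_mul] at this
    simpa using (this.const_mul ((u * v - w * B) * w)).const_sub
      (-(w * B * (qPochInf q u * qPochInf q v)))

/-- The same q-difference equation as in `qSeries_shift`, up to the factors (w)_∞ and (q)_∞ by which
the two sides are normalised. Here the inhomogeneous term is the limit of the telescoping sequence.
-/
lemma phiSeriesReg_shift (hq : ‖q‖ < 1) {u v B n : ℂ} (w : ℂ) (hB : B ≠ 0)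
    (hn : n * B = q * u * v) :
    (u * v - w * B) * phiSeriesReg q u v w (w * B) n q -
      (u - w * B) * (v - w * B) * phiSeriesReg q u v (w * q) (w * q * B) n q =
      -(w * B * (qPochInf q u * qPochInf q v * qPochInf q (w * q) * (qPochInf q q)⁻¹)) := by
  have h := ((hasSum_phiSeriesReg hq hq u v w (w * B) n).mul_left (u * v - w * B)).sub
    ((hasSum_phiSeriesReg hq hq u v (w * q) (w * q * B) n).mul_left ((u - w * B) * (v - w * B)))
  refine h.unique (hasSum_of_telescoping
    (G := fun m => -(w * B * (qPoch q u (m + 1) * qPoch q v (m + 1) * qPoch q (w * q) m *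
      (qPoch q q m)⁻¹ * (qPochInf q (w * B * q ^ (m + 1)) * qPochInf q (n * q ^ m)))))
    h.summable ?_ ?_ ?_)
  · simp only [pow_zero, qPoch_zero, mul_one, div_one, one_mul, zero_add, qPoch_succ, pow_one,
      inv_one]
    rw [qPochInf_eq_mul hq (w * B), show w * q * B = w * B * q by ring]
    ring
  · intro m
    have e1 : w * q * B * q ^ (m + 1) = w * B * q ^ (m + 2) := by ring
    rw [e1, qPoch_succ' q w, inv_qPoch_self hq m, qPochInf_mul_pow_eq hq n m,
      qPochInf_mul_pow_succ_eq hq (w * B) m, qPoch_succ q u (m + 1), qPoch_succ q v (m + 1),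
      qPoch_succ q (w * q) m]
    have key : ((u * v - w * B) * ((1 - w) * (1 - w * B * (q * q ^ m))) -
        (u - w * B) * (v - w * B) * (1 - w * q * q ^ m)) * q ^ (m + 1) =
        -(w * B) * ((1 - u * q ^ (m + 1)) * (1 - v * q ^ (m + 1)) * (1 - w * q * q ^ m) -
          (1 - n * q ^ m) * ((1 - q * q ^ m) * (1 - w * B * (q * q ^ m)))) := by
      have hn' : n = q * u * v / B := by rw [← hn]; field_simp
      rw [hn', pow_succ]
      field_simp
      ring
    linear_combination (qPoch q u (m + 1) * qPoch q v (m + 1) * qPoch q (w * q) m *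
      (qPoch q q (m + 1))⁻¹ *
      (qPochInf q (w * B * q ^ (m + 2)) * qPochInf q (n * q ^ (m + 1)))) * key
  · have t3 := (tendsto_qPoch hq q).inv₀ (qPochInf_ne_zero_of_norm_lt_one hq hq)
    have := (((((tendsto_add_atTop_iff_nat 1).mpr (tendsto_qPoch hq u)).mul
      ((tendsto_add_atTop_iff_nat 1).mpr (tendsto_qPoch hq v))).mul
      (tendsto_qPoch hq (w * q))).mul t3).mul
      (((tendsto_add_atTop_iff_nat 1).mpr (tendsto_qPochInf_mul_pow hq (w * B))).mul
      (tendsto_qPochInf_mul_pow hq n))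
    simpa using (this.const_mul (w * B)).neg

/-- Both sides, as functions of w, solve the same first-order equation and agree at w = n: there one
series stops at once and the other is summed by q-Gauss. Hence they agree at all n q^N, which
accumulate at 0, and the identity theorem on the unit disk finishes. -/
lemma qSeries_eq_phiSeriesReg (hq0 : q ≠ 0) (hq : ‖q‖ < 1) {u v B n w : ℂ} (hB : B ≠ 0)
    (hu0 : u ≠ 0) (hv0 : v ≠ 0) (hu : ‖u‖ < 1) (hv : ‖v‖ < 1) (hn : n * B = q * u * v)
    (hn1 : ‖n‖ < 1) (hw : ‖w‖ < 1) :
    qPochInf q w * qSeries q n w B q (u * q) (v * q) =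
      qPochInf q q * phiSeriesReg q u v w (w * B) n q := by
  have hn0 : n ≠ 0 := left_ne_zero_of_mul (b := B) (by rw [hn]; positivity)
  have hqq : qPochInf q q ≠ 0 := qPochInf_ne_zero_of_norm_lt_one hq hq
  set L : ℂ → ℂ := fun w => qPochInf q w * qSeries q n w B q (u * q) (v * q) with hL
  set H : ℂ → ℂ := fun w => qPochInf q q * phiSeriesReg q u v w (w * B) n q with hH
  have hLstep : ∀ w : ℂ, ‖w‖ < 1 → (u * v - w * B) * L w - (u - w * B) * (v - w * B) * L (w * q) =
      -(w * B * (qPochInf q u * qPochInf q v * qPochInf q (w * q))) := fun w hw => by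
    have := qSeries_shift hq hB hn hw
    simp only [hL]
    rw [qPochInf_eq_mul hq w]
    linear_combination qPochInf q (w * q) * this
  have hHstep : ∀ w : ℂ, (u * v - w * B) * H w - (u - w * B) * (v - w * B) * H (w * q) =
      -(w * B * (qPochInf q u * qPochInf q v * qPochInf q (w * q))) := fun w => by
    have := phiSeriesReg_shift hq w hB hn
    simp only [hH]
    have e : qPochInf q q * (qPochInf q q)⁻¹ = 1 := mul_inv_cancel₀ hqq
    linear_combination qPochInf q q * this - (w * B * (qPochInf q u * qPochInf q v *
      qPochInf q (w * q))) * e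
  have hLn : L n = qPochInf q n * (qPochInf q (u * q) * qPochInf q (v * q)) := by
    simp only [hL, qSeries]
    rw [tsum_eq_single 0 fun k hk => ?_]
    · simp [qTerm]
    · obtain ⟨m, rfl⟩ := Nat.exists_eq_succ_of_ne_zero hk
      simp [qTerm, Finset.prod_range_succ']
  have hHn : H n = qPochInf q n * (qPochInf q (u * q) * qPochInf q (v * q)) := by
    simp only [hH]
    rw [phiSeriesReg_rotate, phiSeriesReg_cancel hq, show n * B = u * v * q by rw [hn]; ring,
      mul_left_comm, qGauss hq u v hq]
  have hzero : ∀ N : ℕ, L (n * q ^ N) = H (n * q ^ N) := by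
    intro N
    induction N with
    | zero => simp [hLn, hHn]
    | succ N ih =>
      have h1 := hLstep _ ((norm_mul_pow_le hq le_rfl N).trans_lt hn1)
      rw [← hHstep, ih, mul_assoc n (q ^ N) q, ← pow_succ, sub_right_inj] at h1
      -- Since n B = q u v, the coefficient (u - wB)(v - wB) at w = n q^N is uv(1 - v q^(N+1))(1 - u
      -- q^(N+1)), which is nonzero for |u|, |v| < 1.
      refine mul_left_cancel₀ (mul_ne_zero ?_ ?_) h1
      · rw [show u - n * q ^ N * B = u * (1 - v * q ^ (N + 1)) by
          linear_combination -q ^ N * hn]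
        exact mul_ne_zero hu0 fun h => notQPole_of_norm_lt_one hq hv (N + 1)
          (by linear_combination -h)
      · rw [show v - n * q ^ N * B = v * (1 - u * q ^ (N + 1)) by
          linear_combination -q ^ N * hn]
        exact mul_ne_zero hv0 fun h => notQPole_of_norm_lt_one hq hu (N + 1)
          (by linear_combination -h)
  have hball : IsOpen (Metric.ball (0 : ℂ) 1) := Metric.isOpen_ball
  have hLd : DifferentiableOn ℂ L (Metric.ball 0 1) :=
    (differentiable_qPochInf hq).differentiableOn.mul
      (differentiableOn_qSeries hq hball (s := fun _ => n) (w := fun w => w) (a := fun _ => B)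
        (b := fun _ => q) (d := fun _ => u * q) (e := fun _ => v * q)
        (fun z hz => by simpa using hz) (by fun_prop) (by fun_prop) (by fun_prop) (by fun_prop)
        (by fun_prop) (by fun_prop))
  have hHd : DifferentiableOn ℂ H (Metric.ball 0 1) := by
    simp only [hH, phiSeriesReg_eq_qSeries]
    exact (differentiableOn_qSeries hq hball (s := fun _ => q * u) (w := fun _ => q)
        (a := fun _ => v) (b := fun w => w) (d := fun w => w * B) (e := fun _ => n)
        (fun z hz => hq) (by fun_prop) (by fun_prop) (by fun_prop) (by fun_prop)
        (by fun_prop) (by fun_prop)).const_mul _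
  have hlim : Tendsto (fun N : ℕ => n * q ^ N) atTop (𝓝[≠] 0) := by
    refine tendsto_nhdsWithin_iff.mpr ⟨?_, Eventually.of_forall fun N => ?_⟩
    · simpa using (tendsto_pow_zero hq).const_mul n
    · exact mul_ne_zero hn0 (pow_ne_zero _ hq0)
  exact (hLd.analyticOnNhd hball).eqOn_of_preconnected_of_frequently_eq (hHd.analyticOnNhd hball)
    (convex_ball 0 1).isPreconnected (Metric.mem_ball_self one_pos)
    (hlim.frequently (Frequently.of_forall hzero)) (by simpa using hw)

/-- The series `(q, ABDλ, ABDqλ²)_∞ ₃φ₂(BDλ, ABλ, ADλ; ABDλ, ABDqλ²; q)`. -/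
noncomputable def stieltjesSeries (q A B D l : ℂ) : ℂ :=
  qPochInf q q *
    phiSeriesReg q (B * D * l) (A * B * l) (A * D * l) (A * B * D * l) (A * B * D * q * l ^ 2) q

lemma differentiable_stieltjesSeries (hq : ‖q‖ < 1) (A B D : ℂ) :
    DifferentiableOn ℂ (stieltjesSeries q A B D) Set.univ := by
  unfold stieltjesSeries
  simp only [phiSeriesReg_eq_qSeries]
  exact (differentiableOn_qSeries hq isOpen_univ (s := fun l => q * (B * D * l)) (w := fun _ => q)
    (a := fun l => A * B * l) (b := fun l => A * D * l) (d := fun l => A * B * D * l)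
    (e := fun l => A * B * D * q * l ^ 2)
    (fun z hz => hq) (by fun_prop) (by fun_prop) (by fun_prop) (by fun_prop)
    (by fun_prop) (by fun_prop)).const_mul _

lemma differentiableOn_solSeries (hq : ‖q‖ < 1) (A B C D x : ℂ) :
    DifferentiableOn ℂ (fun l => solSeries q A B C D l x) {l | ‖A * D * l‖ < 1} := by
  have hU : IsOpen {l : ℂ | ‖A * D * l‖ < 1} := isOpen_lt (by fun_prop) (by fun_prop)
  simp only [solSeries, phiSeriesReg_eq_qSeries]
  exact differentiableOn_qSeries hq hU (s := fun l => A * D * l * (B * C * l))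
    (w := fun l => A * D * l) (a := fun _ => B * x) (b := fun _ => C * x)
    (d := fun l => B * C * D * l * x) (e := fun l => A * B * C * l * x)
    (fun z hz => hz) (by fun_prop) (by fun_prop) (by fun_prop) (by fun_prop)
    (by fun_prop) (by fun_prop)

lemma isPreconnected_norm_mul_lt_one (c : ℂ) : IsPreconnected {l : ℂ | ‖c * l‖ < 1} := by
  have h := (convex_ball (0 : ℂ) 1).linear_preimage (LinearMap.mulLeft ℝ c)
  have e : {l : ℂ | ‖c * l‖ < 1} = LinearMap.mulLeft ℝ c ⁻¹' Metric.ball 0 1 := by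
    ext l
    simp
  rw [e]
  exact h.isPreconnected

lemma eqOn_of_eventuallyEq_zero {f g : ℂ → ℂ} {c : ℂ}
    (hf : DifferentiableOn ℂ f {l | ‖c * l‖ < 1}) (hg : DifferentiableOn ℂ g {l | ‖c * l‖ < 1})
    (h : ∀ᶠ l in 𝓝[≠] (0 : ℂ), f l = g l) {l : ℂ} (hl : ‖c * l‖ < 1) : f l = g l := by
  have hU : IsOpen {l : ℂ | ‖c * l‖ < 1} := isOpen_lt (by fun_prop) (by fun_prop)
  exact (hf.analyticOnNhd hU).eqOn_of_preconnected_of_frequently_eq (hg.analyticOnNhd hU)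
    (isPreconnected_norm_mul_lt_one c) (z₀ := 0) (by simp) h.frequently hl

lemma eventually_norm_lt_one {f : ℂ → ℂ} (hf : Continuous f) (h0 : f 0 = 0) :
    ∀ᶠ l in 𝓝[≠] (0 : ℂ), ‖f l‖ < 1 := by
  refine (hf.norm.continuousAt.eventually_lt_const ?_).filter_mono nhdsWithin_le_nhds
  simp [h0]

lemma solSeries_eq_stieltjesSeries_small (hq0 : q ≠ 0) (hq : ‖q‖ < 1) {A B D l : ℂ}
    (hA : A ≠ 0) (hB : B ≠ 0) (hD : D ≠ 0) (hl : l ≠ 0) (h1 : ‖B * D * l‖ < 1)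
    (h2 : ‖A * B * l‖ < 1) (h3 : ‖A * D * l‖ < 1) (h4 : ‖A * B * D * q * l ^ 2‖ < 1) :
    qPochInf q (A * D * l) * solSeries q A B q D l 1 = stieltjesSeries q A B D l := by
  have h := qSeries_eq_phiSeriesReg hq0 hq hB (u := B * D * l) (v := A * B * l)
    (n := A * B * D * q * l ^ 2) (w := A * D * l) (by positivity) (by positivity) h1 h2 (by ring)
    h4 h3
  rw [stieltjesSeries, solSeries, phiSeriesReg_eq_qSeries]
  convert h using 2 <;> congr 1 <;> ring

/-- The transformation needs several parameters small; analytic continuation in l leaves only |ADl|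
< 1. -/
lemma solSeries_eq_stieltjesSeries (hq0 : q ≠ 0) (hq : ‖q‖ < 1) {A B D l : ℂ}
    (hA : A ≠ 0) (hB : B ≠ 0) (hD : D ≠ 0) (ht : ‖A * D * l‖ < 1) :
    qPochInf q (A * D * l) * solSeries q A B q D l 1 = stieltjesSeries q A B D l := by
  refine eqOn_of_eventuallyEq_zero (c := A * D)
    (f := fun l => qPochInf q (A * D * l) * solSeries q A B q D l 1) ?_
    ((differentiable_stieltjesSeries hq A B D).mono (Set.subset_univ _)) ?_ ht
  · exact ((differentiable_qPochInf hq).comp_differentiableOn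
      (f := fun l => A * D * l) (by fun_prop)).mul (differentiableOn_solSeries hq A B q D 1)
  · filter_upwards [eventually_norm_lt_one (f := fun l => B * D * l) (by fun_prop) (by simp),
      eventually_norm_lt_one (f := fun l => A * B * l) (by fun_prop) (by simp),
      eventually_norm_lt_one (f := fun l => A * D * l) (by fun_prop) (by simp),
      eventually_norm_lt_one (f := fun l => A * B * D * q * l ^ 2) (by fun_prop) (by simp),
      self_mem_nhdsWithin] with l h1 h2 h3 h4 hl
    exact solSeries_eq_stieltjesSeries_small hq0 hq hA hB hD hl h1 h2 h3 h4

lemma recipConvergent_perm (q A B C D z : ℂ) :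
    recipConvergent q A B C D z = recipConvergent q B D A C z := by
  have h1 : coeffA q A B C D = coeffA q B D A C := by
    funext n
    simp only [coeffA]
    ring
  have h2 : coeffBsq q A B C D = coeffBsq q B D A C := by
    funext n
    simp only [coeffBsq]
    rw [show B * D * A * C = A * B * C * D by ring]
    ring
  unfold recipConvergent jFraction
  rw [h1, h2]

lemma tendsto_recipConvergent_perm (hq0 : q ≠ 0) (hq : ‖q‖ < 1) {A B C D l lp : ℂ} (hA : A ≠ 0)
    (hB : B ≠ 0) (hC : C ≠ 0) (hD : D ≠ 0) (nA : NotQPole q A) (nB : NotQPole q B)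
    (nC : NotQPole q C) (nD : NotQPole q D) (hl : l ≠ 0) (hlp : lp = q / (A * B * C * D * l))
    (hr : ‖l / lp‖ < 1) (ht : ‖B * C * l‖ < 1) :
    (solSeries q B D A C l 1 ≠ 0 ∨ lp * solSeries q B D A C l (1 / q) ≠ 0) ∧
    Tendsto (recipConvergent q A B C D (lp + l)) atTop
      (𝓝 (sphereQuot (solSeries q B D A C l 1) (lp * solSeries q B D A C l (1 / q)))) := by
  rw [recipConvergent_perm]
  exact tendsto_recipConvergent hq0 hq hB hD hA hC nB nD nA nC hl (by rw [hlp]; congr 1; ring)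
    hr ht

lemma sphereQuot_eq_sphereQuot {u v u' v' : ℂ} (hv : v ≠ 0) (hv' : v' ≠ 0)
    (h : sphereQuot u v = sphereQuot u' v') : u * v' = u' * v := by
  simp only [sphereQuot, hv, hv', if_false, OnePoint.coe_eq_coe] at h
  rwa [div_eq_div_iff hv hv'] at h

/-- For small l ≠ 0 both the original and the permuted solution represent 1/CF, and both
denominators are known products. Uniqueness of the limit transfers the evaluation of one numerator
to the other, and the identity theorem in l extends it. -/
lemma solSeries_perm_eq_stieltjesSeries (hq0 : q ≠ 0) (hq : ‖q‖ < 1) {A B D l : ℂ}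
    (hA : A ≠ 0) (hB : B ≠ 0) (hD : D ≠ 0) (nA : NotQPole q A) (nB : NotQPole q B)
    (nD : NotQPole q D) (ht : ‖B * q * l‖ < 1) :
    qPochInf q (B * q * l) * solSeries q B D A q l 1 = stieltjesSeries q A B D l := by
  refine eqOn_of_eventuallyEq_zero (c := B * q)
    (f := fun l => qPochInf q (B * q * l) * solSeries q B D A q l 1) ?_
    ((differentiable_stieltjesSeries hq A B D).mono (Set.subset_univ _)) ?_ ht
  · exact ((differentiable_qPochInf hq).comp_differentiableOn
      (f := fun l => B * q * l) (by fun_prop)).mul (differentiableOn_solSeries hq B D A q 1)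
  · filter_upwards [eventually_norm_lt_one (f := fun l => B * D * l) (by fun_prop) (by simp),
      eventually_norm_lt_one (f := fun l => A * B * l) (by fun_prop) (by simp),
      eventually_norm_lt_one (f := fun l => A * D * l) (by fun_prop) (by simp),
      eventually_norm_lt_one (f := fun l => A * B * D * l ^ 2) (by fun_prop) (by simp),
      eventually_norm_lt_one (f := fun l => B * q * l) (by fun_prop) (by simp),
      self_mem_nhdsWithin] with l h1 h2 h3 h4 h5 hl
    have hl : l ≠ 0 := hl
    have nq : NotQPole q q := notQPole_of_norm_lt_one hq hq
    set lp := q / (A * B * q * D * l) with hlp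
    have hlp0 : lp ≠ 0 := by rw [hlp]; positivity
    have hr : ‖l / lp‖ < 1 := by
      rw [show l / lp = A * B * D * l ^ 2 by rw [hlp]; field_simp]
      exact h4
    have g1 := (tendsto_recipConvergent hq0 hq hA hB hq0 hD nA nB nq nD hl hlp hr h3).2
    have g2 := (tendsto_recipConvergent_perm hq0 hq hA hB hq0 hD nA nB nq nD hl hlp hr h5).2
    have p1 := qPochInf_ne_zero_of_norm_lt_one hq h1
    have p2 := qPochInf_ne_zero_of_norm_lt_one hq h2
    have p3 := qPochInf_ne_zero_of_norm_lt_one hq h3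
    have p5 := qPochInf_ne_zero_of_norm_lt_one hq h5
    have s1 := solSeries_inv_of_eq_self hq0 A B D l
    have s2 := solSeries_perm_inv_of_eq_self (A := A) (D := D) hq0 hq h5
    have n1 : solSeries q A B q D l (1 / q) ≠ 0 := by
      rw [s1]
      exact mul_ne_zero p1 p2
    have n2 : solSeries q B D A q l (1 / q) ≠ 0 :=
      right_ne_zero_of_mul (a := qPochInf q (B * q * l))
        (by rw [s2]; exact mul_ne_zero p3 (mul_ne_zero p1 p2))
    have h := sphereQuot_eq_sphereQuot (mul_ne_zero hlp0 n1) (mul_ne_zero hlp0 n2)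
      (tendsto_nhds_unique g1 g2)
    have h4' : ‖A * B * D * q * l ^ 2‖ < 1 := by
      rw [show A * B * D * q * l ^ 2 = q * (A * B * D * l ^ 2) by ring, norm_mul]
      exact mul_lt_one_of_nonneg_of_lt_one_left (norm_nonneg _) hq h4.le
    rw [← solSeries_eq_stieltjesSeries_small hq0 hq hA hB hD hl h1 h2 h3 h4']
    refine mul_left_cancel₀ (mul_ne_zero hlp0 n1) ?_
    linear_combination -qPochInf q (B * q * l) * h + lp * solSeries q A B q D l 1 * s2 -
      lp * qPochInf q (A * D * l) * solSeries q A B q D l 1 * s1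

/-! ### The branch of the square root -/

/-- If 1 - 1/x² = r ≤ 0, then x² = 1/(1 - r) lies in (0, 1], so x lies on the excluded segment. -/
lemma one_sub_inv_sq_mem_slitPlane {x : ℂ} (hx : x ∉ Complex.ofReal '' Set.Icc (-1 : ℝ) 1) :
    1 - 1 / x ^ 2 ∈ Complex.slitPlane := by
  have hx0 : x ≠ 0 := fun h => hx ⟨0, by norm_num, by simp [h]⟩
  by_contra hs
  rw [Complex.mem_slitPlane_iff] at hs
  push Not at hs
  obtain ⟨r, hr⟩ : ∃ r : ℝ, 1 - 1 / x ^ 2 = r :=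
    ⟨(1 - 1 / x ^ 2).re, Complex.ext (Complex.ofReal_re _).symm (by rw [hs.2, Complex.ofReal_im])⟩
  have hr0 : r ≤ 0 := by
    have := hs.1
    rwa [hr, Complex.ofReal_re] at this
  set c := Real.sqrt (1 - r)⁻¹ with hc
  have h1 : (0 : ℝ) < 1 - r := by linarith
  have hc2 : c ^ 2 = (1 - r)⁻¹ := Real.sq_sqrt (inv_nonneg.mpr h1.le)
  have hc0 : 0 ≤ c := Real.sqrt_nonneg _
  have hc1 : c ≤ 1 := by
    exact Real.sqrt_le_one.mpr (inv_le_one_of_one_le₀ (by linarith))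
  have hx2 : x ^ 2 = (c : ℂ) ^ 2 := by
    have h2 : (1 - r : ℂ) ≠ 0 := by exact_mod_cast h1.ne'
    rw [← Complex.ofReal_pow, hc2, Complex.ofReal_inv, Complex.ofReal_sub, Complex.ofReal_one, ← hr]
    simp
  rcases sq_eq_sq_iff_eq_or_eq_neg.mp hx2 with h | h
  · exact hx ⟨c, ⟨by linarith, hc1⟩, h.symm⟩
  · exact hx ⟨-c, ⟨by linarith, by linarith⟩, by simp [h]⟩

lemma re_cpow_half_pos {u : ℂ} (hu : u ∈ Complex.slitPlane) : 0 < (u ^ (1 / 2 : ℂ)).re := by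
  rw [Complex.mem_slitPlane_iff_arg] at hu
  rw [Complex.cpow_def_of_ne_zero hu.2, Complex.exp_re]
  refine mul_pos (Real.exp_pos _) (Real.cos_pos_of_mem_Ioo ?_)
  have : (Complex.log u * (1 / 2)).im = u.arg / 2 := by
    rw [show (1 / 2 : ℂ) = ((1 / 2 : ℝ) : ℂ) by norm_num, Complex.im_mul_ofReal, Complex.log_im]
    ring
  rw [this]
  have h1 := Complex.neg_pi_lt_arg u
  have h2 := lt_of_le_of_ne (Complex.arg_le_pi u) hu.1
  constructor <;> linarith

lemma cpow_half_sq (u : ℂ) : (u ^ (1 / 2 : ℂ)) ^ 2 = u := by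
  have := Complex.cpow_nat_inv_pow u two_ne_zero
  rwa [Nat.cast_ofNat, ← one_div] at this

lemma ne_zero_of_mem_offCut {α z : ℂ} (hz : z ∈ offCut α) : α * z ≠ 0 :=
  fun h => hz ⟨0, by norm_num, by simp [h]⟩

lemma sqrtBranch_sq {x : ℂ} (hx : x ≠ 0) : sqrtBranch x ^ 2 = x ^ 2 - 1 := by
  rw [sqrtBranch, mul_pow, cpow_half_sq]
  field_simp

lemma lamPlus_add_lamMinus {α : ℂ} (hα : α ≠ 0) (z : ℂ) : lamPlus α z + lamMinus α z = z := by
  unfold lamPlus lamMinus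
  field_simp
  ring

lemma lamPlus_mul_lamMinus {α z : ℂ} (hz : z ∈ offCut α) :
    lamPlus α z * lamMinus α z = 1 / (2 * α) ^ 2 := by
  have := sqrtBranch_sq (ne_zero_of_mem_offCut hz)
  rw [lamPlus, lamMinus, div_mul_div_comm, ← sq (2 * α)]
  congr 1
  linear_combination -this

/-- The ratio is (1 - w)/(1 + w), where w is a principal square root with positive real part, hence
closer to 1 than to -1. -/
lemma norm_lamMinus_div_lamPlus_lt_one {α z : ℂ} (hz : z ∈ offCut α) :
    ‖lamMinus α z / lamPlus α z‖ < 1 := by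
  have hx0 := ne_zero_of_mem_offCut hz
  have hα : α ≠ 0 := left_ne_zero_of_mul hx0
  have hw := re_cpow_half_pos (one_sub_inv_sq_mem_slitPlane hz)
  set w := (1 - 1 / (α * z) ^ 2) ^ (1 / 2 : ℂ) with hwdef
  have h1 : lamMinus α z / lamPlus α z = (1 - w) / (1 + w) := by
    rw [lamMinus, lamPlus, div_div_div_cancel_right₀ (by simpa using hα), sqrtBranch, ← hwdef,
      show α * z - α * z * w = α * z * (1 - w) by ring,
      show α * z + α * z * w = α * z * (1 + w) by ring, mul_div_mul_left _ _ hx0]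
  have h2 : ‖1 - w‖ < ‖1 + w‖ := by
    rw [← sq_lt_sq₀ (norm_nonneg _) (norm_nonneg _), ← Complex.normSq_eq_norm_sq,
      ← Complex.normSq_eq_norm_sq, Complex.normSq_apply, Complex.normSq_apply]
    simp only [Complex.sub_re, Complex.one_re, Complex.sub_im, Complex.one_im, Complex.add_re,
      Complex.add_im]
    linarith
  rw [h1, norm_div, div_lt_one ((norm_nonneg _).trans_lt h2)]
  exact h2

lemma continuousOn_sqrtBranch_mul (α : ℂ) :
    ContinuousOn (fun z => sqrtBranch (α * z)) (offCut α) := by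
  unfold sqrtBranch
  refine ContinuousOn.mul (by fun_prop) (ContinuousOn.cpow ?_ continuousOn_const fun z hz =>
    one_sub_inv_sq_mem_slitPlane hz)
  exact continuousOn_const.sub (continuousOn_const.div (by fun_prop) fun z hz =>
    pow_ne_zero _ (ne_zero_of_mem_offCut hz))

lemma continuousOn_lamPlus (α : ℂ) : ContinuousOn (lamPlus α) (offCut α) :=
  ((continuousOn_const.mul continuousOn_id).add (continuousOn_sqrtBranch_mul α)).div_const _

lemma continuousOn_lamMinus (α : ℂ) : ContinuousOn (lamMinus α) (offCut α) :=
  ((continuousOn_const.mul continuousOn_id).sub (continuousOn_sqrtBranch_mul α)).div_const _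

/-! ### The function `φ` and the minimal solution -/

lemma qPochInf_mul_phiSeries (hq : ‖q‖ < 1) (a b c : ℂ) {d e : ℂ} (z : ℂ) (hd : NotQPole q d)
    (he : NotQPole q e) :
    qPochInf q d * qPochInf q e * phiSeries q a b c d e z = phiSeriesReg q a b c d e z := by
  unfold phiSeries phiSeriesReg
  rw [← tsum_mul_left]
  refine tsum_congr fun k => ?_
  rw [← qPoch_mul_qPochInf hq d k, ← qPoch_mul_qPochInf hq e k]
  have := hd.qPoch_ne_zero k
  have := he.qPoch_ne_zero k
  have := qPoch_self_ne_zero hq k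
  field_simp

lemma qPochInf_mul_phi_of_norm_lt_one (hq : ‖q‖ < 1) {A B C D l x : ℂ} (hB : B ≠ 0) (hC : C ≠ 0)
    (hl : l ≠ 0) (hx : x ≠ 0) (ht : ‖A * D * l‖ < 1) (hd : NotQPole q (B * C * D * l * x))
    (he : NotQPole q (A * B * C * l * x)) :
    qPochInf q (B * C * D * l * x) * qPochInf q (A * B * C * l * x) *
      phi q (B * C * l) (B * x) (C * x) (B * C * D * l * x) (A * B * C * l * x) =
      solSeries q A B C D l x := by
  have e1 : B * C * D * l * x * (A * B * C * l * x) / (B * C * l * (B * x) * (C * x)) =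
      A * D * l := by field_simp
  rw [phi, e1, if_pos ht, qPochInf_mul_phiSeries hq _ _ _ _ hd he, solSeries]

/-- The continuation formula for φ is, up to infinite products, the solution series for the permuted
parameters (B, D, A, C). -/
lemma qPochInf_mul_phi_of_one_le_norm (hq : ‖q‖ < 1) {A B C D l x : ℂ} (hB : B ≠ 0) (hC : C ≠ 0)
    (hl : l ≠ 0) (hx : x ≠ 0) (ht : ¬ ‖A * D * l‖ < 1) (hd : NotQPole q (B * C * D * l * x))
    (he : NotQPole q (A * B * C * l * x)) (ht' : NotQPole q (A * D * l)) :
    qPochInf q (B * C * D * l * x) * qPochInf q (A * B * C * l * x) * qPochInf q (A * D * l) *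
      phi q (B * C * l) (B * x) (C * x) (B * C * D * l * x) (A * B * C * l * x) =
      qPochInf q (B * C * l) * solSeries q B D A C l x := by
  have e1 : B * C * D * l * x * (A * B * C * l * x) / (B * C * l * (B * x) * (C * x)) =
      A * D * l := by field_simp
  have e2 : B * C * D * l * x / (B * C * l) = D * x := by field_simp
  have e3 : A * B * C * l * x / (B * C * l) = A * x := by field_simp
  have e4 : B * C * D * l * x * (A * B * C * l * x) / (B * C * l * (B * x)) =
      D * A * C * l * x := by field_simp
  have e5 : B * C * D * l * x * (A * B * C * l * x) / (B * C * l * (C * x)) =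
      B * D * A * l * x := by field_simp
  have h1 := qPochInf_ne_zero hq hd
  have h2 := qPochInf_ne_zero hq he
  have h3 := qPochInf_ne_zero hq ht'
  rw [phi, e1, if_neg ht, e2, e3, e4, e5, solSeries, mul_comm D A]
  generalize qPochInf q (B * C * D * l * x) = X at h1 ⊢
  generalize qPochInf q (A * B * C * l * x) = Y at h2 ⊢
  generalize qPochInf q (A * D * l) = Z at h3 ⊢
  field_simp

/-- The product of ADl and BCl is q l/lp, of modulus less than 1. -/
lemma norm_mul_lt_one_or (hq : ‖q‖ < 1) {A B C D l lp : ℂ} (hA : A ≠ 0)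
    (hB : B ≠ 0) (hC : C ≠ 0) (hD : D ≠ 0) (hl : l ≠ 0) (hq0 : q ≠ 0)
    (hlp : lp = q / (A * B * C * D * l)) (hr : ‖l / lp‖ < 1) :
    ‖A * D * l‖ < 1 ∨ ‖B * C * l‖ < 1 := by
  by_contra! h
  have hprod : A * D * l * (B * C * l) = q * (l / lp) := by
    rw [hlp]
    field_simp
  have h1 := one_le_mul_of_one_le_of_one_le h.1 h.2
  rw [← norm_mul, hprod, norm_mul] at h1
  exact absurd h1 (not_le.mpr (mul_lt_one_of_nonneg_of_lt_one_left (norm_nonneg _) hq hr.le))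

/-- The minimal solution of the recurrence, with its normalisation. -/
lemma exists_minimal_solution (hq0 : q ≠ 0) (hq : ‖q‖ < 1) {A B C D l lp : ℂ} (hA : A ≠ 0)
    (hB : B ≠ 0) (hC : C ≠ 0) (hD : D ≠ 0) (nA : NotQPole q A) (nB : NotQPole q B)
    (nC : NotQPole q C) (nD : NotQPole q D) (hl : l ≠ 0) (hlp : lp = q / (A * B * C * D * l))
    (hr : ‖l / lp‖ < 1) :
    ∃ (S : ℂ → ℂ) (c : ℂ), (S 1 ≠ 0 ∨ lp * S (1 / q) ≠ 0) ∧
      Tendsto (recipConvergent q A B C D (lp + l)) atTop (𝓝 (sphereQuot (S 1) (lp * S (1 / q)))) ∧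
      c ≠ 0 ∧
      (∀ x : ℂ, x ≠ 0 → NotQPole q (B * C * D * l * x) → NotQPole q (A * B * C * l * x) →
        NotQPole q (A * D * l) →
        qPochInf q (B * C * D * l * x) * qPochInf q (A * B * C * l * x) * qPochInf q (A * D * l) *
          phi q (B * C * l) (B * x) (C * x) (B * C * D * l * x) (A * B * C * l * x) = c * S x) ∧
      (C = q → c * S (1 / q) = qPochInf q (B * D * l) * qPochInf q (A * B * l) *
          qPochInf q (A * D * l) ∧ c * S 1 = stieltjesSeries q A B D l) := by
  by_cases ht : ‖A * D * l‖ < 1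
  · obtain ⟨h1, h2⟩ := tendsto_recipConvergent hq0 hq hA hB hC hD nA nB nC nD hl hlp hr ht
    -- The constant c makes c S(x) the same expression in φ for both choices of S: here it is
    -- (ADl)_∞, and (BCl)_∞ in the permuted case.
    refine ⟨_, qPochInf q (A * D * l), h1, h2, qPochInf_ne_zero_of_norm_lt_one hq ht, ?_, ?_⟩
    · intro x hx hd he _
      rw [← qPochInf_mul_phi_of_norm_lt_one hq hB hC hl hx ht hd he]
      ring
    · rintro rfl
      exact ⟨by rw [solSeries_inv_of_eq_self hq0]; ring,
        solSeries_eq_stieltjesSeries hq0 hq hA hB hD ht⟩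
  · have ha := (norm_mul_lt_one_or hq hA hB hC hD hl hq0 hlp hr).resolve_left ht
    obtain ⟨h1, h2⟩ := tendsto_recipConvergent_perm hq0 hq hA hB hC hD nA nB nC nD hl hlp hr ha
    refine ⟨_, qPochInf q (B * C * l), h1, h2, qPochInf_ne_zero_of_norm_lt_one hq ha, ?_, ?_⟩
    · intro x hx hd he hn
      exact qPochInf_mul_phi_of_one_le_norm hq hB hC hl hx ht hd he hn
    · rintro rfl
      exact ⟨by rw [solSeries_perm_inv_of_eq_self hq0 hq ha]; ring,
        solSeries_perm_eq_stieltjesSeries hq0 hq hA hB hD nA nB nD ha⟩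

/-! ### Continuity of the limit and quotients on the sphere -/

lemma continuousWithinAt_of_eq_sphereQuot (hq : ‖q‖ < 1) {A B C D : ℂ} {R : ℂ → OnePoint ℂ}
    {U : Set ℂ} {lm lp : ℂ → ℂ} (hlm : ContinuousOn lm U) (hlp : ContinuousOn lp U)
    (hR : ∀ z ∈ U, ‖A * D * lm z‖ < 1 →
      (solSeries q A B C D (lm z) 1 ≠ 0 ∨ lp z * solSeries q A B C D (lm z) (1 / q) ≠ 0) ∧
      R z = sphereQuot (solSeries q A B C D (lm z) 1)
        (lp z * solSeries q A B C D (lm z) (1 / q))) {z₀ : ℂ} (hz₀ : z₀ ∈ U)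
    (h : ‖A * D * lm z₀‖ < 1) : ContinuousWithinAt R U z₀ := by
  have hU : IsOpen {l : ℂ | ‖A * D * l‖ < 1} := isOpen_lt (by fun_prop) (by fun_prop)
  have hS : ∀ x, Tendsto (fun z => solSeries q A B C D (lm z) x) (𝓝[U] z₀)
      (𝓝 (solSeries q A B C D (lm z₀) x)) := fun x =>
    ((differentiableOn_solSeries hq A B C D x).continuousOn.continuousAt
      (hU.mem_nhds h)).tendsto.comp (hlm z₀ hz₀)
  obtain ⟨h1, h2⟩ := hR z₀ hz₀ h
  unfold ContinuousWithinAt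
  rw [h2]
  refine (tendsto_sphereQuot (hS 1) ((hlp z₀ hz₀).tendsto.mul (hS (1 / q))) h1).congr' ?_
  filter_upwards [(hlm z₀ hz₀).eventually (hU.mem_nhds h), self_mem_nhdsWithin] with z hz hzU
  exact (hR z hzU hz).2.symm

lemma eqQuot_of_eq_mul {u v u' v' k : ℂ} (h : u ≠ 0 ∨ v ≠ 0) (hk : k ≠ 0) (hu : u' = k * u)
    (hv : v' = k * v) : EqQuot (sphereQuot u v) u' v' := by
  subst hu hv
  refine ⟨?_, (sphereQuot_mul_left hk u v).symm⟩
  simpa [hk] using h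

lemma sphereQuot_eq_infty_iff {u v : ℂ} : sphereQuot u v = OnePoint.infty ↔ v = 0 := by
  by_cases hv : v = 0 <;> simp [sphereQuot, hv]

lemma notQPole_of_coeffBsq_ne_zero {A B C D : ℂ}
    (hb : ∀ n : ℤ, 0 < n → coeffBsq q A B C D n ≠ 0) :
    NotQPole q A ∧ NotQPole q B ∧ NotQPole q C ∧ NotQPole q D := by
  have key : ∀ k : ℕ, (1 - A * q ^ k) * (1 - B * q ^ k) * (1 - C * q ^ k) * (1 - D * q ^ k) ≠ 0 :=
    fun k h => hb (k + 1 : ℕ) (by positivity) (by rw [coeffBsq_succ, h, mul_zero])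
  refine ⟨fun k h => key k ?_, fun k h => key k ?_, fun k h => key k ?_, fun k h => key k ?_⟩ <;>
    simp [h]

end DualQHahn

/-! ### Assembly of the theorem -/

open DualQHahn in
theorem mainTheorem2 (q A B C D α : ℂ) (hq0 : q ≠ 0) (hq1 : ‖q‖ < 1)
    (hA : A ≠ 0) (hB : B ≠ 0) (hC : C ≠ 0) (hD : D ≠ 0)
    (hb : ∀ n : ℤ, 0 < n → DualQHahn.coeffBsq q A B C D n ≠ 0)
    (hα : (2 * α) ^ 2 = A * B * C * D / q) :
    ∃ R : ℂ → OnePoint ℂ, ContinuousOn R (DualQHahn.offCut α) ∧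
      ∀ z ∈ DualQHahn.offCut α, ∀ lp lm : ℂ,
        lp = DualQHahn.lamPlus α z → lm = DualQHahn.lamMinus α z →
        -- the square root branch is the one with `|λ₋ / λ₊| < 1`
        (DualQHahn.sqrtBranch (α * z) ^ 2 = (α * z) ^ 2 - 1 ∧ lp ≠ 0 ∧ ‖lm / lp‖ < 1) ∧
        -- the continued fraction converges on the Riemann sphere, and `1 / CF(z) = R z`
        Tendsto (DualQHahn.recipConvergent q A B C D z) atTop (𝓝 (R z)) ∧
        -- the two forms of the representation as a ratio of two `₃φ₂`
        (DualQHahn.NotQPole q (B * C * D * lm / q) → DualQHahn.NotQPole q (A * B * C * lm / q) →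
          DualQHahn.NotQPole q (A * D * lm) →
          DualQHahn.EqQuot (R z)
            (A * B * C * D * lm *
              DualQHahn.phi q (B * C * lm) B C (B * C * D * lm) (A * B * C * lm))
            (q * (1 - B * C * D * lm / q) * (1 - A * B * C * lm / q) *
              DualQHahn.phi q (B * C * lm) (B / q) (C / q)
                (B * C * D * lm / q) (A * B * C * lm / q)) ∧
          DualQHahn.EqQuot (R z)
            (DualQHahn.phi q (B * C * lm) B C (q / (A * lp)) (q / (D * lp)))
            (lp * (1 - 1 / (A * lp)) * (1 - 1 / (D * lp)) *
              DualQHahn.phi q (B * C * lm) (B / q) (C / q) (1 / (A * lp)) (1 / (D * lp)))) ∧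
        -- the case `C = q`: the two single-series forms, and the poles
        (C = q →
          (DualQHahn.NotQPole q (D * B * q * lm) → DualQHahn.NotQPole q (A * B * q * lm) →
            DualQHahn.NotQPole q (A * D * lm) →
            DualQHahn.EqQuot (R z)
              (A * B * D * lm *
                DualQHahn.phi q (B * q * lm) B q (D * B * q * lm) (A * B * q * lm))
              ((1 - B * D * lm) * (1 - A * B * lm))) ∧
          (DualQHahn.NotQPole q (A * B * D * lm) →
            DualQHahn.EqQuot (R z)
              (A * B * D * lm *
                (DualQHahn.qPochInf q q * DualQHahn.qPochInf q (A * B * D * lm) *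
                  DualQHahn.qPochInf q (A * B * D * q * lm ^ 2)) *
                DualQHahn.phiSeries q (B * D * lm) (A * B * lm) (A * D * lm)
                  (A * B * D * lm) (A * B * D * q * lm ^ 2) q)
              (DualQHahn.qPochInf q (B * D * lm) * DualQHahn.qPochInf q (A * B * lm) *
                DualQHahn.qPochInf q (A * D * lm))) ∧
          (R z = OnePoint.infty ↔
            DualQHahn.qPochInf q (B * D * lm) * DualQHahn.qPochInf q (A * B * lm) *
              DualQHahn.qPochInf q (A * D * lm) = 0)) := by
  have hq := hq1
  have hABCD : A * B * C * D ≠ 0 := by positivity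
  have hα0 : α ≠ 0 := by
    rintro rfl
    rw [mul_zero, zero_pow two_ne_zero] at hα
    exact div_ne_zero hABCD hq0 hα.symm
  obtain ⟨nA, nB, nC, nD⟩ := notQPole_of_coeffBsq_ne_zero hb
  have hprod : ∀ z ∈ offCut α, lamPlus α z * lamMinus α z = q / (A * B * C * D) := fun z hz => by
    rw [lamPlus_mul_lamMinus hz, hα, one_div_div]
  have hl0 : ∀ z ∈ offCut α, lamMinus α z ≠ 0 := fun z hz =>
    right_ne_zero_of_mul (a := lamPlus α z) (by rw [hprod z hz]; exact div_ne_zero hq0 hABCD)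
  have hlp : ∀ z ∈ offCut α, lamPlus α z = q / (A * B * C * D * lamMinus α z) := fun z hz => by
    rw [← div_div, ← hprod z hz, mul_div_cancel_right₀ _ (hl0 z hz)]
  have hlim : ∀ z ∈ offCut α, ∀ w, Tendsto (recipConvergent q A B C D (lamPlus α z + lamMinus α z))
      atTop (𝓝 w) → limUnder atTop (recipConvergent q A B C D z) = w := fun z _ w h => by
    rw [lamPlus_add_lamMinus hα0] at h
    exact h.limUnder_eq
  refine ⟨fun z => limUnder atTop (recipConvergent q A B C D z), ?_, ?_⟩
  · intro z hz
    have hr := norm_lamMinus_div_lamPlus_lt_one hz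
    -- The regions |ADλ₋| < 1 and |BCλ₋| < 1 are relatively open and cover Ω; on each, the limit is
    -- a quotient of continuous functions without common zeros.
    rcases norm_mul_lt_one_or hq hA hB hC hD (hl0 z hz) hq0 (hlp z hz) hr with h | h
    · refine continuousWithinAt_of_eq_sphereQuot (B := B) (C := C) hq (continuousOn_lamMinus α)
        (continuousOn_lamPlus α) (fun w hw hw1 => ?_) hz h
      have := tendsto_recipConvergent hq0 hq hA hB hC hD nA nB nC nD (hl0 w hw) (hlp w hw)
        (norm_lamMinus_div_lamPlus_lt_one hw) hw1
      exact ⟨this.1, hlim w hw _ this.2⟩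
    · refine continuousWithinAt_of_eq_sphereQuot (B := D) (C := A) hq (continuousOn_lamMinus α)
        (continuousOn_lamPlus α) (fun w hw hw1 => ?_) hz h
      have := tendsto_recipConvergent_perm hq0 hq hA hB hC hD nA nB nC nD (hl0 w hw) (hlp w hw)
        (norm_lamMinus_div_lamPlus_lt_one hw) hw1
      exact ⟨this.1, hlim w hw _ this.2⟩
  intro z hz lp lm hlpz hlmz
  have hl : lm ≠ 0 := hlmz ▸ hl0 z hz
  have hlp' : lp = q / (A * B * C * D * lm) := by rw [hlpz, hlmz, hlp z hz]
  have hlp0 : lp ≠ 0 := by rw [hlp']; positivity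
  have hr : ‖lm / lp‖ < 1 := by
    rw [hlpz, hlmz]
    exact norm_lamMinus_div_lamPlus_lt_one hz
  have hsum : lp + lm = z := by rw [hlpz, hlmz, lamPlus_add_lamMinus hα0]
  obtain ⟨S, c, hne, hT, hc, hphi, hCq⟩ :=
    exists_minimal_solution hq0 hq hA hB hC hD nA nB nC nD hl hlp' hr
  rw [hsum] at hT
  have hR : limUnder atTop (recipConvergent q A B C D z) = sphereQuot (S 1) (lp * S (1 / q)) :=
    hT.limUnder_eq
  simp only [hR]
  refine ⟨⟨sqrtBranch_sq (ne_zero_of_mem_offCut hz), hlp0, hr⟩, hT, ?_, ?_⟩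
  · intro hd he ht
    have hd1 : NotQPole q (B * C * D * lm) := by simpa [hq0] using hd.mul_self
    have he1 : NotQPole q (A * B * C * lm) := by simpa [hq0] using he.mul_self
    have h0 := hphi 1 one_ne_zero (by rwa [mul_one]) (by rwa [mul_one]) ht
    have hm := hphi (1 / q) (one_div_ne_zero hq0) (by rwa [mul_one_div]) (by rwa [mul_one_div]) ht
    simp only [mul_one] at h0
    simp only [mul_one_div] at hm
    have e1 : q / (A * lp) = B * C * D * lm := by rw [hlp']; field_simp
    have e2 : q / (D * lp) = A * B * C * lm := by rw [hlp']; field_simp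
    have e3 : 1 / (A * lp) = B * C * D * lm / q := by rw [hlp']; field_simp
    have e4 : 1 / (D * lp) = A * B * C * lm / q := by rw [hlp']; field_simp
    rw [qPochInf_eq_mul hq (B * C * D * lm / q), qPochInf_eq_mul hq (A * B * C * lm / q),
      div_mul_cancel₀ _ hq0, div_mul_cancel₀ _ hq0] at hm
    have p1 := qPochInf_ne_zero hq hd1
    have p2 := qPochInf_ne_zero hq he1
    have p3 := qPochInf_ne_zero hq ht
    set P := qPochInf q (B * C * D * lm) * qPochInf q (A * B * C * lm) * qPochInf q (A * D * lm)
      with hP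
    have hP0 : P ≠ 0 := mul_ne_zero (mul_ne_zero p1 p2) p3
    have h0' : phi q (B * C * lm) B C (B * C * D * lm) (A * B * C * lm) = c / P * S 1 := by
      rw [div_mul_eq_mul_div, eq_div_iff hP0, ← h0]
      ring
    have hm' : (1 - B * C * D * lm / q) * (1 - A * B * C * lm / q) *
        phi q (B * C * lm) (B / q) (C / q) (B * C * D * lm / q) (A * B * C * lm / q) =
        c / P * S (1 / q) := by
      rw [div_mul_eq_mul_div, eq_div_iff hP0, ← hm]
      ring
    -- This relation turns the factor λ₊ of the denominator into the factor ABCDλ₋/q of the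
    -- numerator, so both forms are one quotient rescaled.
    have hq' : A * B * C * D * lm * lp = q := by rw [hlp']; field_simp
    rw [e1, e2, e3, e4]
    constructor
    · refine eqQuot_of_eq_mul hne (k := A * B * C * D * lm * (c / P)) ?_ ?_ ?_
      · exact mul_ne_zero (mul_ne_zero hABCD hl) (div_ne_zero hc hP0)
      · rw [h0']
        ring
      · rw [mul_assoc q, mul_assoc q, hm']
        linear_combination -(c / P * S (1 / q)) * hq'
    · refine eqQuot_of_eq_mul hne (k := c / P) (div_ne_zero hc hP0) h0' ?_
      rw [mul_assoc lp, mul_assoc lp, hm']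
      ring
  · intro hCq'
    obtain ⟨g1, g2⟩ := hCq hCq'
    -- From here on the base q is written `C`.
    subst hCq'
    have hq' : A * B * D * lm * lp = 1 := by rw [hlp']; field_simp
    refine ⟨?_, ?_, ?_⟩
    · intro hd he ht
      have e1 : D * B * C * lm = B * C * D * lm := by ring
      rw [e1] at hd ⊢
      have h0 := hphi 1 one_ne_zero (by rwa [mul_one]) (by rwa [mul_one]) ht
      simp only [mul_one] at h0
      have p1 := qPochInf_ne_zero hq hd
      have p2 := qPochInf_ne_zero hq he
      have p3 := qPochInf_ne_zero hq ht
      set P := qPochInf C (B * C * D * lm) * qPochInf C (A * B * C * lm) * qPochInf C (A * D * lm)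
        with hP
      have hP0 : P ≠ 0 := mul_ne_zero (mul_ne_zero p1 p2) p3
      have h0' : phi C (B * C * lm) B C (B * C * D * lm) (A * B * C * lm) = c / P * S 1 := by
        rw [div_mul_eq_mul_div, eq_div_iff hP0, ← h0]
        ring
      have g1' : c * S (1 / C) = (1 - B * D * lm) * (1 - A * B * lm) * P := by
        rw [g1, qPochInf_eq_mul hq (B * D * lm), qPochInf_eq_mul hq (A * B * lm), hP,
          show B * D * lm * C = B * C * D * lm by ring, show A * B * lm * C = A * B * C * lm by ring]
        ring
      refine eqQuot_of_eq_mul hne (k := A * B * D * lm * (c / P)) ?_ ?_ ?_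
      · exact mul_ne_zero (by positivity) (div_ne_zero hc hP0)
      · rw [h0']
        ring
      · have : c / P * S (1 / C) = (1 - B * D * lm) * (1 - A * B * lm) := by
          rw [div_mul_eq_mul_div, g1', mul_div_cancel_right₀ _ hP0]
        linear_combination -this - (c / P * S (1 / C)) * hq'
    · intro hm
      -- The second lower parameter equals q λ₋/λ₊, of modulus less than 1, so it never gives a
      -- pole.
      have hn : NotQPole C (A * B * D * C * lm ^ 2) := by
        refine notQPole_of_norm_lt_one hq ?_
        rw [show A * B * D * C * lm ^ 2 = C * (lm / lp) by rw [hlp']; field_simp, norm_mul]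
        exact mul_lt_one_of_nonneg_of_lt_one_left (norm_nonneg _) hq hr.le
      refine eqQuot_of_eq_mul hne (k := A * B * D * lm * c) (by positivity) ?_ ?_
      · rw [mul_assoc _ c, g2, stieltjesSeries, ← qPochInf_mul_phiSeries hq _ _ _ _ hm hn]
        ring
      · rw [← g1]
        linear_combination -(c * S (1 / C)) * hq'
    · rw [sphereQuot_eq_infty_iff, ← g1, mul_eq_zero, mul_eq_zero]
      simp [hlp0, hc]
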